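/- Let $H$ and $U$ be (real or complex) Hilbert spaces, let $A_1:\mathcal D(A_1)\subset H\to H$ be a self-adjoint, positive and boundedly invertible operator. For $s\ge 0$ let $H_s=\mathcal D(A_1^s)$ with $\|z\|_{H_s}=\|A_1^sz\|_H$, and let $H_{-s}$ be the dual of $H_s$ with respect to the pivot space $H$, equivalently the completion of $H$ for the norm $\|z\|_{H_{-s}}=\|A_1^{-s}z\|_H$. Let $B_1:U\to H_{-1/2}$ be a bounded linear operator, with adjoint $B_1^*:H_{1/2}\to U$ ($U$ being identified with its dual). Let $\alpha>-\frac12$ and $T>0$. Then the following are equivalent. (1) ($\alpha$-weak observability in time $T$.) There is a constant $C_T>0$ such that for all $(z^0,z^1)\in H_1\times H_{1/2}$ the solution $\phi$ of $\ddot\phi+A_1\phi=0$, $\phi(0)=z^0$, $\dot\phi(0)=z^1$ satisfies $$\int_0^T\|B_1^*\phi(t)\|_U^2\,dt\;\ge\; C_T\left(\|z^0\|^2_{H_{-\alpha}}+\|z^1\|^2_{H_{-\alpha-\frac12}}\right).$$ (2) ($\alpha$-weak controllability in time $T$.) There is a constant $C>0$ such that for all $(z^0,z^1)\in H_1\times H_{1/2}$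 with $z^0\in H_{\alpha+\frac12}$ and $z^1\in H_\alpha$ (no restriction if $\alpha\le\frac12$) there is a control $v\in L^2(0,T;U)$, extended by zero to $(T,\infty)$, with $$\|v\|^2_{L^2(0,T;U)}\;\le\; C\left(\|z^0\|^2_{H_{\alpha+\frac12}}+\|z^1\|^2_{H_\alpha}\right),$$ such that the solution $z$ of $\ddot z+A_1z=B_1v$, $z(0)=z^0$, $\dot z(0)=z^1$ satisfies $z(t)=0$ for all $t\ge T$. Here the solution of the controlled system is the unique $z\in C([0,\infty);H)\cap C^1([0,\infty);H_{-1/2})$ with $z(0)=z^0$, $\dot z(0)=z^1$, such that for all $t\ge0$ one has $\int_0^tz\,ds\in H_{1/2}$ and $$\dot z(t)-z^1+A_1\int_0^tz(s)\,ds=\int_0^tB_1v(s)\,ds\quad\text{in }H_{-1/2}.$$ -/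

import Mathlib

open MeasureTheory Set
open scoped ENNReal InnerProductSpace

namespace WaveControl

noncomputable section

set_option linter.unusedSectionVars false

variable {𝕜 : Type*} [RCLike 𝕜]
  {H : Type*} [NormedAddCommGroup H] [InnerProductSpace 𝕜 H] [CompleteSpace H]
  [NormedSpace ℝ H] [IsScalarTower ℝ 𝕜 H]
  {U : Type*} [NormedAddCommGroup U] [InnerProductSpace 𝕜 U] [CompleteSpace U]

/-! ### The operator and its fractional powers -/

/-- `R` is a bounded, everywhere defined, two-sided inverse of the unbounded operator `A`. -/
def IsBoundedInverse (A : H →ₗ.[𝕜] H) (R : H →L[𝕜] H) : Prop :=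
  (∀ x : H, ∃ h : R x ∈ A.domain, A ⟨R x, h⟩ = x) ∧ ∀ x : A.domain, R (A x) = x

/-- `A` is a densely defined self-adjoint, positive and boundedly invertible operator on `H`. -/
structure IsPositiveInvertible (A : H →ₗ.[𝕜] H) : Prop where
  dense_domain : Dense (A.domain : Set H)
  isSelfAdjoint : IsSelfAdjoint A
  nonneg : ∀ x : A.domain, 0 ≤ RCLike.re ⟪A x, (x : H)⟫_𝕜
  invertible : ∃ R : H →L[𝕜] H, IsBoundedInverse A R

open Classical in
/-- The bounded inverse `A⁻¹` (zero if `A` is not boundedly invertible). -/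
def boundedInverse (A : H →ₗ.[𝕜] H) : H →L[𝕜] H :=
  if h : ∃ R : H →L[𝕜] H, IsBoundedInverse A R then h.choose else 0

/-- The power `A ^ (-σ)` for `0 < σ < 1` by Balakrishnan's formula
`A ^ (-σ) = c⁻¹ ∫₀^∞ r ^ (-σ) (r + A)⁻¹ dr`, where `c = ∫₀^∞ r ^ (-σ) / (1 + r) dr = π / sin (π σ)`
and where the resolvent `(r + A)⁻¹` is written as `A⁻¹ (1 + r A⁻¹)⁻¹`. -/
def balakrishnan (A : H →ₗ.[𝕜] H) (σ : ℝ) : H →L[𝕜] H :=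
  (∫ r in Ioi (0 : ℝ), r ^ (-σ) / (1 + r))⁻¹ •
    ∫ r in Ioi (0 : ℝ), r ^ (-σ) •
      (boundedInverse A * Ring.inverse (1 + r • boundedInverse A))

/-- The bounded operator `A ^ (-s)` for `0 ≤ s`, as `(A⁻¹) ^ n` times `A ^ (-σ)` with `n` the
integer part and `σ` the fractional part of `s`. -/
def negPow (A : H →ₗ.[𝕜] H) (s : ℝ) : H →L[𝕜] H :=
  boundedInverse A ^ ⌊s⌋₊ * (if Int.fract s = 0 then 1 else balakrishnan A (Int.fract s))

/-- The power `A ^ s` for real `s`, as an operator in `H` with domain: for `s ≤ 0` it is bounded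
and everywhere defined, for `0 < s` it is the inverse of `A ^ (-s)`, with domain the range of
`A ^ (-s)`. -/
def pow (A : H →ₗ.[𝕜] H) (s : ℝ) : H →ₗ.[𝕜] H :=
  if s ≤ 0 then ((negPow A (-s) : H →L[𝕜] H) : H →ₗ[𝕜] H).toPMap ⊤
  else (((negPow A s : H →L[𝕜] H) : H →ₗ[𝕜] H).toPMap ⊤).inverse

/-! ### The scale of spaces -/

/-- The space `H_s = D(A ^ s)` for `0 ≤ s`, with the norm `‖z‖_s = ‖A ^ s z‖`. -/
def Scale (A : H →ₗ.[𝕜] H) (s : ℝ) : Type _ := (pow A s).domain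

namespace Scale

variable (A : H →ₗ.[𝕜] H) (s : ℝ)

instance : AddCommGroup (Scale A s) := inferInstanceAs (AddCommGroup (pow A s).domain)

instance : Module 𝕜 (Scale A s) := inferInstanceAs (Module 𝕜 (pow A s).domain)

/-- The operator `A ^ s : H_s → H`. -/
def powMap : Scale A s →ₗ[𝕜] H := (pow A s).toFun

instance : SeminormedAddCommGroup (Scale A s) :=
  SeminormedAddCommGroup.induced _ H (powMap A s)

instance : NormedSpace 𝕜 (Scale A s) := NormedSpace.induced 𝕜 (Scale A s) H (powMap A s)

/-- The inclusion `H_s → H`. -/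
def incl : Scale A s →ₗ[𝕜] H := (pow A s).domain.subtype

theorem norm_eq (x : Scale A s) : ‖x‖ = ‖powMap A s x‖ := rfl

/-- The isometry `A ^ s : H_s → H` as a continuous linear map. -/
def powL : Scale A s →L[𝕜] H :=
  (powMap A s).mkContinuous 1 fun x => by rw [one_mul]; exact (norm_eq A s x).ge

end Scale

/-- The space `H_{-s}` for `0 ≤ s`: the dual of `H_s` with respect to the pivot space `H`. Its
elements are the bounded conjugate-linear functionals on `H_s`; an element `z` of `H` is identified
with the functional `ψ ↦ ⟪ψ, z⟫`. -/
abbrev NegScale (A : H →ₗ.[𝕜] H) (s : ℝ) : Type _ := Scale A s →L⋆[𝕜] 𝕜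

/-- The dual norm on `H_{-s}` is definite. -/
instance (A : H →ₗ.[𝕜] H) (s : ℝ) : NormedAddCommGroup (NegScale A s) :=
  NormedAddCommGroup.ofSeparation fun f hf => by
    ext x
    have h := f.le_opNorm x
    rw [hf, zero_mul] at h
    simpa using h

/-- `w ∈ H_{-s}` is the element `z` of the pivot space `H`. -/
def NegScale.IsOfPivot {A : H →ₗ.[𝕜] H} {s : ℝ} (w : NegScale A s) (z : H) : Prop :=
  ∀ ψ : Scale A s, w ψ = ⟪Scale.incl A s ψ, z⟫_𝕜

/-- The extension `A : H_{1/2} → H_{-1/2}`, given by `⟨ψ, A x⟩ = ⟪A ^ (1/2) ψ, A ^ (1/2) x⟫`. -/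
def extA (A : H →ₗ.[𝕜] H) (x : Scale A (1 / 2)) : NegScale A (1 / 2) :=
  ((innerSL 𝕜).flip (Scale.powL A (1 / 2) x)).comp (Scale.powL A (1 / 2))

open Classical in
/-- The norm `‖z‖_s = ‖A ^ s z‖` of an element `z` of `H`, for any real `s`; it is `∞` if `0 < s`
and `z` is not in `H_s`. For `s < 0` it is the norm of which `H_s` is the completion of `H`. -/
def scaleNorm (A : H →ₗ.[𝕜] H) (s : ℝ) (z : H) : ℝ≥0∞ :=
  if h : z ∈ (pow A s).domain then ‖pow A s ⟨z, h⟩‖ₑ else ∞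

/-- The adjoint `B* : H_{1/2} → U` of `B : U → H_{-1/2}`, where `U` is identified with its dual:
`⟪B* ψ, u⟫ = (B u) ψ`. -/
def adjointOp {A : H →ₗ.[𝕜] H} (B : U →L[𝕜] NegScale A (1 / 2)) : Scale A (1 / 2) →L[𝕜] U :=
  ((InnerProductSpace.toDual 𝕜 U).symm.toContinuousLinearEquiv :
    StrongDual 𝕜 U →L⋆[𝕜] U).comp B.flip

theorem inner_adjointOp {A : H →ₗ.[𝕜] H} (B : U →L[𝕜] NegScale A (1 / 2))
    (ψ : Scale A (1 / 2)) (u : U) : ⟪adjointOp B ψ, u⟫_𝕜 = B u ψ := by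
  simp [adjointOp]

/-! ### The free and the controlled system -/

/-- `φ` solves `φ'' + A φ = 0`, `φ(0) = z₀`, `φ'(0) = z₁` on `[0, ∞)`, where
`φ ∈ C([0,∞); H_1)` and `φ' ∈ C([0,∞); H_{1/2})`, and the derivatives are taken in `H`. -/
structure IsFreeSolution (A : H →ₗ.[𝕜] H) (z₀ z₁ : H) (φ φ' : ℝ → Scale A (1 / 2)) : Prop where
  init : Scale.incl A _ (φ 0) = z₀
  init_vel : Scale.incl A _ (φ' 0) = z₁
  continuousOn_vel : ContinuousOn φ' (Ici 0)
  hasDeriv : ∀ t ∈ Ici (0 : ℝ), HasDerivWithinAt (fun r => Scale.incl A _ (φ r))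
    (Scale.incl A _ (φ' t)) (Ici 0) t
  eqn : ∃ Aφ : ℝ → H, ContinuousOn Aφ (Ici 0) ∧ ∀ t ∈ Ici (0 : ℝ),
    (∃ h : Scale.incl A _ (φ t) ∈ A.domain, A ⟨Scale.incl A _ (φ t), h⟩ = Aφ t) ∧
    HasDerivWithinAt (fun r => Scale.incl A _ (φ' r)) (-Aφ t) (Ici 0) t

/-- `z` solves `z'' + A z = B v`, `z(0) = z₀`, `z'(0) = z₁` on `[0, ∞)`, with velocity `w = z'`.
Here `z ∈ C([0,∞); H) ∩ C¹([0,∞); H_{-1/2})`, and the equation holds in `H_{-1/2}` in its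
time-integrated form `z'(t) - z'(0) + A ∫₀ᵗ z = ∫₀ᵗ B v`, each term of which is in `H_{-1/2}`. -/
structure IsControlledSolution {A : H →ₗ.[𝕜] H} (B : U →L[𝕜] NegScale A (1 / 2)) (z₀ z₁ : H)
    (v : ℝ → U) (z : ℝ → H) (w : ℝ → NegScale A (1 / 2)) : Prop where
  continuousOn : ContinuousOn z (Ici 0)
  continuousOn_vel : ContinuousOn w (Ici 0)
  init : z 0 = z₀
  init_vel : (w 0).IsOfPivot z₁
  hasDeriv : ∃ ι : ℝ → NegScale A (1 / 2), ∀ t ∈ Ici (0 : ℝ),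
    (ι t).IsOfPivot (z t) ∧ HasDerivWithinAt ι (w t) (Ici 0) t
  eqn : ∀ t ∈ Ici (0 : ℝ), ∃ Z : Scale A (1 / 2), Scale.incl A _ Z = ∫ r in (0 : ℝ)..t, z r ∧
    w t - w 0 + extA A Z = ∫ r in (0 : ℝ)..t, B (v r)

/-! ### Observability and controllability -/

/-- The `α`-weak observability inequality in time `T`:
`∫₀ᵀ ‖B* φ(t)‖² dt ≥ C (‖z₀‖²_{-α} + ‖z₁‖²_{-α-1/2})` for all `(z₀, z₁) ∈ H_1 × H_{1/2}`, where
`φ` is the solution of the free system with data `(z₀, z₁)`. -/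
def IsWeaklyObservable {A : H →ₗ.[𝕜] H} (B : U →L[𝕜] NegScale A (1 / 2)) (α T : ℝ) : Prop :=
  ∃ C : ℝ, 0 < C ∧ ∀ z₀ ∈ A.domain, ∀ z₁ ∈ (pow A (1 / 2)).domain,
    ∀ φ φ' : ℝ → Scale A (1 / 2), IsFreeSolution A z₀ z₁ φ φ' →
      ENNReal.ofReal C * (scaleNorm A (-α) z₀ ^ 2 + scaleNorm A (-α - 1 / 2) z₁ ^ 2) ≤
        ∫⁻ t in Icc 0 T, ‖adjointOp B (φ t)‖ₑ ^ 2

/-- `α`-weak controllability in time `T`: there is `C` such that for all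
`(z₀, z₁) ∈ H_1 × H_{1/2}` which lie in `H_{α+1/2} × H_α` there is a control `v ∈ L²(0,T;U)`,
extended by zero, with `‖v‖² ≤ C (‖z₀‖²_{α+1/2} + ‖z₁‖²_α)`, for which the solution of the
controlled system with data `(z₀, z₁)` vanishes at all times `t ≥ T`. -/
def IsWeaklyControllable {A : H →ₗ.[𝕜] H} (B : U →L[𝕜] NegScale A (1 / 2)) (α T : ℝ) : Prop :=
  ∃ C : ℝ, 0 < C ∧ ∀ z₀ ∈ A.domain, z₀ ∈ (pow A (α + 1 / 2)).domain →
    ∀ z₁ ∈ (pow A (1 / 2)).domain, z₁ ∈ (pow A α).domain →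
      ∃ v : ℝ → U, MemLp v 2 (volume.restrict (Icc 0 T)) ∧
        ∫⁻ t in Icc 0 T, ‖v t‖ₑ ^ 2 ≤
          ENNReal.ofReal C * (scaleNorm A (α + 1 / 2) z₀ ^ 2 + scaleNorm A α z₁ ^ 2) ∧
        ∃ (z : ℝ → H) (w : ℝ → NegScale A (1 / 2)),
          IsControlledSolution B z₀ z₁ ((Icc 0 T).indicator v) z w ∧ ∀ t, T ≤ t → z t = 0

end

end WaveControl

/-! The theorem is the duality between a bound from below for an operator and solvability of an
equation for its adjoint. Write the data of the free system as z⁰ = A⁻¹a, z¹ = A^(-1/2)b with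
arbitrary a, b in H. Then A^(1/2)φ(t) = A^(-1/2)(cos(tA^(1/2))a + sin(tA^(1/2))b), and the output
B*φ defines a linear map Λ from H × H to L²(0,T;U). In these coordinates both observed norms carry
the same weight, and observability reads C(‖A^(-α-1)a‖² + ‖A^(-α-1)b‖²) ≤ ‖Λ(a,b)‖²
(`isWeaklyObservable_iff`).

On the control side, variation of constants shows that v steers (z⁰,z¹) to rest exactly when ∫
sin(rA^(1/2))A^(-1/2)Bv dr = z⁰ and ∫ cos(rA^(1/2))A^(-1/2)Bv dr = -A^(-1/2)z¹ over (0,T). Tested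
against (a,b), this says that ⟨Λ(a,b), v⟩ is a prescribed functional of (a,b)
(`exists_isControlledSolution_indicator_iff`). Given observability, that functional is bounded by a
multiple of ‖Λ(a,b)‖, so Hahn–Banach and Riesz produce v with the required norm
(`exists_inner_eq_of_norm_le`). Conversely, controls for data adapted to (a,b) give observability by
Cauchy–Schwarz.

The analytic input is kept bounded. Powers and trigonometric functions of A come from a continuous
functional calculus `fc` for A⁻¹, built from polynomials. The second-order equations become a
first-order system for two H-valued functions, with A^(-1/2) in front of the derivatives;
`system_unique` and `system_exists` solve it by rotating with cos(tA^(1/2)) and sin(tA^(1/2)). -/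

open MeasureTheory Set
open scoped ENNReal InnerProductSpace

namespace WaveControl

noncomputable section

set_option linter.unusedSectionVars false

/-! ### Continuous functional calculus of a bounded positive operator -/

section FunctionalCalculus

variable {𝕜 : Type*} [RCLike 𝕜]
  {H : Type*} [NormedAddCommGroup H] [InnerProductSpace 𝕜 H]

/-- A polynomial in a symmetric operator on a finite-dimensional space is bounded by the
supremum of the polynomial over an interval containing the numerical range. -/
theorem norm_aeval_apply_le_of_finiteDimensional [FiniteDimensional 𝕜 H] {S : H →ₗ[𝕜] H}
    (hS : S.IsSymmetric) {M C : ℝ} (h0 : ∀ x, 0 ≤ RCLike.re ⟪S x, x⟫_𝕜)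
    (hM : ∀ x, RCLike.re ⟪S x, x⟫_𝕜 ≤ M * ‖x‖ ^ 2) (p : Polynomial ℝ) (hC : 0 ≤ C)
    (hp : ∀ a ∈ Icc 0 M, |p.eval a| ≤ C) (x : H) :
    ‖Polynomial.aeval S (p.map (algebraMap ℝ 𝕜)) x‖ ≤ C * ‖x‖ := by
  set b := hS.eigenvectorBasis rfl
  set e := hS.eigenvalues rfl
  have hb : ∀ i, S (b i) = (e i : 𝕜) • b i := fun i => hS.apply_eigenvectorBasis rfl i
  have he : ∀ i, e i ∈ Icc 0 M := by
    intro i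
    have h : RCLike.re ⟪S (b i), b i⟫_𝕜 = e i := by
      simp [hb, inner_smul_left]
    constructor
    · exact h ▸ h0 (b i)
    · simpa [h] using hM (b i)
  have hpb : ∀ i, Polynomial.aeval S (p.map (algebraMap ℝ 𝕜)) (b i)
      = ((p.eval (e i) : ℝ) : 𝕜) • b i := by
    intro i
    rw [Module.End.aeval_apply_of_hasEigenvector
      ⟨Module.End.mem_eigenspace_iff.2 (hb i), b.orthonormal.ne_zero i⟩]
    congr 1
    have := Polynomial.eval_map_algebraMap (B := 𝕜) p (e i : 𝕜)
    rw [this]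
    exact (Polynomial.aeval_algebraMap_apply_eq_algebraMap_eval (A := 𝕜) (e i) p)
  have hx : Polynomial.aeval S (p.map (algebraMap ℝ 𝕜)) x
      = ∑ i, (((p.eval (e i) : ℝ) : 𝕜) * ⟪b i, x⟫_𝕜) • b i := by
    conv_lhs => rw [← b.sum_repr' x]
    simp [hpb, smul_smul, mul_comm]
  refine le_of_sq_le_sq ?_ (by positivity)
  rw [mul_pow, ← b.sum_sq_norm_inner_right x, ← b.sum_sq_norm_inner_right, Finset.mul_sum]
  refine Finset.sum_le_sum fun i _ => ?_
  rw [hx, b.orthonormal.inner_right_fintype, norm_mul, mul_pow]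
  gcongr
  simpa using hp _ (he i)

/-- A polynomial in a positive operator on a Hilbert space is bounded by the supremum of the
polynomial over an interval containing the numerical range. -/
theorem norm_aeval_map_apply_le {S : H →ₗ[𝕜] H}
    (hS : S.IsSymmetric) {M C : ℝ} (h0 : ∀ x, 0 ≤ RCLike.re ⟪S x, x⟫_𝕜)
    (hM : ∀ x, RCLike.re ⟪S x, x⟫_𝕜 ≤ M * ‖x‖ ^ 2) (p : Polynomial ℝ) (hC : 0 ≤ C)
    (hp : ∀ a ∈ Icc 0 M, |p.eval a| ≤ C) (x : H) :
    ‖Polynomial.aeval S (p.map (algebraMap ℝ 𝕜)) x‖ ≤ C * ‖x‖ := by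
  set n := p.natDegree
  -- The Krylov space of x up to degree n. The compression of S to it is symmetric, has numerical
  -- range inside that of S, and has the same powers at x up to order n, so the bound reduces to
  -- finite dimension without any spectral theorem for S.
  set V : Submodule 𝕜 H := Submodule.span 𝕜 (range fun k : Fin (n + 1) => (S ^ (k : ℕ)) x)
  have : FiniteDimensional 𝕜 V := FiniteDimensional.span_of_finite 𝕜 (finite_range _)
  have hmem : ∀ k ≤ n, (S ^ k) x ∈ V := fun k hk =>
    Submodule.subset_span ⟨⟨k, by lia⟩, rfl⟩
  set SV : V →ₗ[𝕜] V := V.orthogonalProjectionOnto.toLinearMap ∘ₗ S ∘ₗ V.subtype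
  have hin : ∀ u v : V, ⟪SV u, v⟫_𝕜 = ⟪S u, (v : H)⟫_𝕜 := by
    intro u v
    simp [SV]
  have hSV : SV.IsSymmetric := by
    intro u v
    rw [hin, ← inner_conj_symm u, hin, inner_conj_symm]
    exact hS _ _
  have hpow : ∀ k ≤ n, (((SV ^ k) ⟨x, by simpa using hmem 0 (Nat.zero_le _)⟩ : V) : H)
      = (S ^ k) x := by
    intro k
    induction k with
    | zero => simp
    | succ k ih =>
      intro hk
      rw [pow_succ', pow_succ', Module.End.mul_apply, Module.End.mul_apply, ← ih (by lia)]
      have : S ((SV ^ k) ⟨x, by simpa using hmem 0 (Nat.zero_le _)⟩ : V) ∈ V := by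
        rw [ih (by lia), ← Module.End.mul_apply, ← pow_succ']
        exact hmem _ hk
      simpa [SV] using Submodule.starProjection_eq_self_iff.2 this
  have key : ((Polynomial.aeval SV (p.map (algebraMap ℝ 𝕜))
      ⟨x, by simpa using hmem 0 (Nat.zero_le _)⟩ : V) : H)
      = Polynomial.aeval S (p.map (algebraMap ℝ 𝕜)) x := by
    rw [Polynomial.aeval_eq_sum_range, Polynomial.aeval_eq_sum_range]
    simp only [LinearMap.sum_apply, LinearMap.smul_apply, Submodule.coe_sum, Submodule.coe_smul]
    refine Finset.sum_congr rfl fun k hk => ?_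
    rw [hpow]
    have := Polynomial.natDegree_map_le (f := algebraMap ℝ 𝕜) (p := p)
    have := Finset.mem_range.1 hk
    lia
  rw [← key]
  exact norm_aeval_apply_le_of_finiteDimensional hSV (fun u => by rw [hin]; exact h0 _)
    (fun u => by rw [hin]; exact hM _) p hC hp _

variable [CompleteSpace H] [NormedSpace ℝ H] [IsScalarTower ℝ 𝕜 H]

/-- Real polynomials as continuous functions on `[0, M]`. -/
abbrev polyOn (M : ℝ) : Polynomial ℝ →ₐ[ℝ] C(Icc 0 M, ℝ) :=
  Polynomial.toContinuousMapOnAlgHom (Icc 0 M)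

theorem denseRange_polyOn (M : ℝ) : DenseRange (polyOn M) := by
  intro f
  have := continuousMap_mem_polynomialFunctions_closure 0 M f
  rwa [← SetLike.mem_coe, Subalgebra.topologicalClosure_coe, polynomialFunctions_coe] at this

/-- The numerical range of R lies in [0, ‖R‖]. This estimate lets p ↦ p(R) extend from polynomials
to continuous functions; the factor 1 is the constant that the extension asks for. -/
theorem norm_aeval_le {R : H →L[𝕜] H} (hR : R.IsPositive) (p : Polynomial ℝ) :
    ‖Polynomial.aeval R p‖ ≤ 1 * ‖polyOn ‖R‖ p‖ := by
  refine ContinuousLinearMap.opNorm_le_bound _ (by positivity) fun x => ?_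
  have h : Polynomial.aeval R p x
      = Polynomial.aeval (R : H →ₗ[𝕜] H) (p.map (algebraMap ℝ 𝕜)) x := by
    rw [Polynomial.aeval_map_algebraMap, Polynomial.aeval_eq_sum_range,
      Polynomial.aeval_eq_sum_range]
    simp only [sum_apply, LinearMap.sum_apply]
    refine Finset.sum_congr rfl fun k _ => ?_
    simp [← ContinuousLinearMap.toLinearMap_pow]
  rw [h, one_mul]
  refine norm_aeval_map_apply_le (fun x y => hR.isSymmetric x y) hR.re_inner_nonneg_left (M := ‖R‖)
    (fun x => ?_) p
    (norm_nonneg _) (fun a ha => ?_) x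
  · refine (RCLike.re_le_norm _).trans ((norm_inner_le_norm _ _).trans ?_)
    rw [pow_two, ← mul_assoc]
    gcongr
    exact R.le_opNorm x
  · exact (polyOn ‖R‖ p).norm_coe_le_norm ⟨a, ha⟩

/-- The continuous functional calculus of a bounded positive operator. -/
def fc (R : H →L[𝕜] H) : C(Icc 0 ‖R‖, ℝ) →L[ℝ] (H →L[𝕜] H) :=
  (Polynomial.aeval R).toLinearMap.extendOfNorm (polyOn ‖R‖).toLinearMap

variable {R : H →L[𝕜] H} (hR : R.IsPositive)
include hR

theorem fc_polyOn (p : Polynomial ℝ) : fc R (polyOn ‖R‖ p) = Polynomial.aeval R p :=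
  LinearMap.extendOfNorm_eq (e := (polyOn ‖R‖).toLinearMap) (denseRange_polyOn _)
    ⟨1, norm_aeval_le hR⟩ p

theorem fc_mul (f g : C(Icc 0 ‖R‖, ℝ)) : fc R (f * g) = fc R f * fc R g := by
  induction f, g using (denseRange_polyOn ‖R‖).induction_on₂ with
  | hp => exact isClosed_eq (by fun_prop) (by fun_prop)
  | h p q => rw [← map_mul, fc_polyOn hR, fc_polyOn hR, fc_polyOn hR, map_mul]

theorem fc_one : fc R 1 = 1 := by
  rw [← map_one (polyOn ‖R‖), fc_polyOn hR, map_one]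

theorem fc_id : fc R (polyOn ‖R‖ Polynomial.X) = R := by
  rw [fc_polyOn hR, Polynomial.aeval_X]

theorem inner_fc (f : C(Icc 0 ‖R‖, ℝ)) (x y : H) : ⟪fc R f x, y⟫_𝕜 = ⟪x, fc R f y⟫_𝕜 := by
  induction f using (denseRange_polyOn ‖R‖).induction_on with
  | hp => exact isClosed_eq (by fun_prop) (by fun_prop)
  | ih p =>
    rw [fc_polyOn hR]
    have hpow : ∀ (k : ℕ) (x y : H), ⟪(R ^ k) x, y⟫_𝕜 = ⟪x, (R ^ k) y⟫_𝕜 := by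
      intro k
      induction k with
      | zero => simp
      | succ k ih =>
        intro x y
        rw [pow_succ, mul_apply_eq_comp, ih, hR.inner_left_eq_inner_right, ← mul_apply_eq_comp,
          (Commute.self_pow R k).eq]
    rw [Polynomial.aeval_eq_sum_range]
    simp only [sum_apply, sum_inner, inner_sum,
      smul_apply]
    refine Finset.sum_congr rfl fun k _ => ?_
    -- Real coefficients, viewed in 𝕜, are fixed by conjugation and so pass through both slots of
    -- the inner product.
    rw [← algebraMap_smul 𝕜 (p.coeff k) ((R ^ k) x), ← algebraMap_smul 𝕜 (p.coeff k) ((R ^ k) y),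
      inner_smul_left, inner_smul_right, hpow]
    simp

end FunctionalCalculus

section Powers

/-! ### Fractional powers and the functional calculus -/

/-- The function `a ↦ a ^ s` on `[0, M]`, for `0 ≤ s`. -/
def rpowOn (M s : ℝ) : C(Icc 0 M, ℝ) where
  toFun a := (a : ℝ) ^ max s 0
  continuous_toFun := continuous_subtype_val.rpow_const fun _ => Or.inr (le_max_right _ _)

theorem rpowOn_apply (M : ℝ) {s : ℝ} (hs : 0 ≤ s) (a : Icc 0 M) :
    rpowOn M s a = (a : ℝ) ^ s := by
  simp [rpowOn, hs]

theorem rpowOn_add (M : ℝ) {s t : ℝ} (hs : 0 ≤ s) (ht : 0 ≤ t) :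
    rpowOn M (s + t) = rpowOn M s * rpowOn M t := by
  ext a
  rw [ContinuousMap.mul_apply, rpowOn_apply M hs, rpowOn_apply M ht,
    rpowOn_apply M (add_nonneg hs ht),
    Real.rpow_add_of_nonneg a.2.1 hs ht]

/-- The function `a ↦ a / (1 + |r| a)` on `[0, M]`. -/
def resolventOn (M r : ℝ) : C(Icc 0 M, ℝ) where
  toFun a := a / (1 + |r| * a)
  continuous_toFun := by
    refine Continuous.div (by fun_prop) (by fun_prop) fun a => ?_
    have := mul_nonneg (abs_nonneg r) a.2.1
    positivity

theorem continuous_resolventOn (M : ℝ) : Continuous (resolventOn M) := by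
  refine ContinuousMap.continuous_of_continuous_uncurry _ ?_
  refine Continuous.div (by fun_prop) (by fun_prop) fun a => ?_
  have := mul_nonneg (abs_nonneg a.1) a.2.2.1
  positivity

/-- For r > 0 the sup norm of a / (1 + ra) is at most |M| and at most 1/r. The first bound gives
integrability near 0 since σ < 1, the second at infinity since σ > 0. -/
theorem integrableOn_resolventOn (M : ℝ) {σ : ℝ} (h0 : 0 < σ) (h1 : σ < 1) :
    IntegrableOn (fun r => r ^ (-σ) • resolventOn M r) (Ioi 0) := by
  have hm : ∀ s ⊆ Ioi (0 : ℝ), MeasurableSet s →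
      AEStronglyMeasurable (fun r => r ^ (-σ) • resolventOn M r) (volume.restrict s) := by
    intro s hs hsm
    refine ContinuousOn.aestronglyMeasurable ?_ hsm
    have hc : ContinuousOn (fun r : ℝ => r ^ (-σ)) s := fun r hr =>
      (Real.continuousAt_rpow_const _ _ (Or.inl (ne_of_gt (hs hr)))).continuousWithinAt
    exact hc.smul (continuous_resolventOn M).continuousOn
  have hn : ∀ r : ℝ, 0 < r → ‖r ^ (-σ) • resolventOn M r‖ = r ^ (-σ) * ‖resolventOn M r‖ := by
    intro r hr
    rw [norm_smul, Real.norm_of_nonneg (Real.rpow_nonneg hr.le _)]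
  rw [← Ioc_union_Ioi_eq_Ioi zero_le_one]
  refine IntegrableOn.union ?_ ?_
  · have hi : IntegrableOn (fun r : ℝ => r ^ (-σ) * |M|) (Ioc 0 1) :=
      ((intervalIntegrable_iff_integrableOn_Ioc_of_le zero_le_one).1
        (intervalIntegral.intervalIntegrable_rpow' (by linarith))).mul_const _
    refine hi.mono' (hm _ (fun r hr => hr.1) measurableSet_Ioc) ?_
    filter_upwards [ae_restrict_mem measurableSet_Ioc] with r hr
    rw [hn r hr.1]
    refine mul_le_mul_of_nonneg_left ?_ (Real.rpow_nonneg hr.1.le _)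
    refine (ContinuousMap.norm_le _ (abs_nonneg _)).2 fun a => ?_
    have := mul_nonneg (abs_nonneg r) a.2.1
    have h := a.2.1
    rw [Real.norm_of_nonneg (by simp only [resolventOn, ContinuousMap.coe_mk]; positivity)]
    exact (div_le_self h (by linarith)).trans (a.2.2.trans (le_abs_self _))
  · have hi : IntegrableOn (fun r : ℝ => r ^ (-σ - 1)) (Ioi 1) :=
      integrableOn_Ioi_rpow_of_lt (by linarith) zero_lt_one
    refine hi.mono' (hm _ (Ioi_subset_Ioi zero_le_one) measurableSet_Ioi) ?_
    filter_upwards [ae_restrict_mem measurableSet_Ioi] with r hr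
    have hr0 : 0 < r := zero_lt_one.trans hr
    rw [hn r hr0, Real.rpow_sub_one hr0.ne', div_eq_mul_inv]
    refine mul_le_mul_of_nonneg_left ?_ (Real.rpow_nonneg hr0.le _)
    refine (ContinuousMap.norm_le _ (by positivity)).2 fun a => ?_
    have := mul_nonneg (abs_nonneg r) a.2.1
    have h := a.2.1
    rw [Real.norm_of_nonneg (by simp only [resolventOn, ContinuousMap.coe_mk]; positivity)]
    simp only [resolventOn, ContinuousMap.coe_mk]
    rw [abs_of_pos hr0] at *
    rw [div_le_iff₀ (by positivity)]
    have : r⁻¹ * (1 + r * a) = r⁻¹ + a := by field_simp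
    rw [this]
    have := inv_pos.2 hr0
    linarith

theorem integral_rpow_div_pos {σ : ℝ} (h0 : 0 < σ) (h1 : σ < 1) :
    0 < ∫ r in Ioi (0 : ℝ), r ^ (-σ) / (1 + r) := by
  have hi : IntegrableOn (fun r : ℝ => r ^ (-σ) / (1 + r)) (Ioi 0) := by
    have := (ContinuousMap.evalCLM ℝ (⟨1, by simp⟩ : Icc (0 : ℝ) 1)).integrable_comp
      (integrableOn_resolventOn 1 h0 h1)
    refine (integrableOn_congr_fun (fun r hr => ?_) measurableSet_Ioi).1 this
    simp [resolventOn, abs_of_pos (mem_Ioi.1 hr), div_eq_mul_inv]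
  rw [setIntegral_pos_iff_support_of_nonneg_ae _ hi]
  · have : Function.support (fun r : ℝ => r ^ (-σ) / (1 + r)) ∩ Ioi 0 = Ioi 0 := by
      refine inter_eq_right.2 fun r hr => ?_
      have hr' : 0 < r := hr
      have : 0 < r ^ (-σ) / (1 + r) := by positivity
      exact this.ne'
    rw [this]
    simp
  · filter_upwards [ae_restrict_mem measurableSet_Ioi] with r hr
    have hr' : 0 < r := hr
    have : 0 < r ^ (-σ) / (1 + r) := by positivity
    exact this.le

/-- Evaluation at a point commutes with the integral, and for a > 0 the substitution r ↦ ar pulls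
out the factor a^σ. At a = 0 both sides vanish. -/
theorem integral_resolventOn (M : ℝ) {σ : ℝ} (h0 : 0 < σ) (h1 : σ < 1) :
    ∫ r in Ioi (0 : ℝ), r ^ (-σ) • resolventOn M r
      = (∫ r in Ioi (0 : ℝ), r ^ (-σ) / (1 + r)) • rpowOn M σ := by
  ext a
  have h := (ContinuousMap.evalCLM ℝ a).integral_comp_comm (integrableOn_resolventOn M h0 h1)
  change ∫ r in Ioi (0 : ℝ), (r ^ (-σ) • resolventOn M r) a
    = (∫ r in Ioi (0 : ℝ), r ^ (-σ) • resolventOn M r) a at h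
  rw [← h, ContinuousMap.smul_apply, rpowOn_apply M h0.le]
  simp only [ContinuousMap.smul_apply, smul_eq_mul, resolventOn, ContinuousMap.coe_mk]
  rcases a.2.1.eq_or_lt with ha | ha
  · simp [← ha, Real.zero_rpow h0.ne']
  · have h2 := integral_comp_mul_left_Ioi (fun r : ℝ => r ^ (-σ) / (1 + r)) 0 ha
    rw [mul_zero, smul_eq_mul, inv_mul_eq_div, eq_div_iff ha.ne'] at h2
    rw [← h2, ← integral_mul_const, ← integral_mul_const]
    refine setIntegral_congr_fun measurableSet_Ioi fun r hr => ?_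
    have hr' : 0 < r := hr
    rw [abs_of_pos hr', Real.mul_rpow ha.le hr'.le, Real.rpow_neg ha.le]
    have := (Real.rpow_pos_of_pos ha σ).ne'
    field_simp

variable {𝕜 : Type*} [RCLike 𝕜]
  {H : Type*} [NormedAddCommGroup H] [InnerProductSpace 𝕜 H] [CompleteSpace H]
  [NormedSpace ℝ H] [IsScalarTower ℝ 𝕜 H]

theorem fc_rpowOn_zero {R : H →L[𝕜] H} (hR : R.IsPositive) : fc R (rpowOn ‖R‖ 0) = 1 := by
  rw [← fc_one hR]
  congr 1
  ext a
  simp [rpowOn]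

theorem fc_rpowOn_natCast {R : H →L[𝕜] H} (hR : R.IsPositive) (n : ℕ) :
    fc R (rpowOn ‖R‖ n) = R ^ n := by
  rw [← Polynomial.aeval_X_pow (R := ℝ) R, ← fc_polyOn hR]
  congr 1
  ext a
  simp [rpowOn]

/-- The function 1 + ra has no zero on [0, ‖R‖], so by multiplicativity its reciprocal yields the
inverse of 1 + rR. -/
theorem mul_inverse_eq_fc {R : H →L[𝕜] H} (hR : R.IsPositive) {r : ℝ} (hr : 0 < r) :
    R * Ring.inverse (1 + r • R) = fc R (resolventOn ‖R‖ r) := by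
  set f : C(Icc 0 ‖R‖, ℝ) := 1 + r • polyOn ‖R‖ Polynomial.X
  have hf : ∀ a, f a = 1 + r * a := fun a => by simp [f]
  have hpos : ∀ a, f a ≠ 0 := fun a => by
    have := mul_nonneg hr.le a.2.1
    rw [hf]
    positivity
  set g : C(Icc 0 ‖R‖, ℝ) := ⟨fun a => (f a)⁻¹, f.continuous.inv₀ hpos⟩
  have hfg : f * g = 1 := by
    ext a
    exact mul_inv_cancel₀ (hpos a)
  have hfR : fc R f = 1 + r • R := by
    rw [map_add, map_smul, fc_one hR, fc_id hR]
  let u : (H →L[𝕜] H)ˣ := ⟨fc R f, fc R g, by rw [← fc_mul hR, hfg, fc_one hR],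
    by rw [← fc_mul hR, mul_comm, hfg, fc_one hR]⟩
  have hu : Ring.inverse (1 + r • R) = fc R g := by
    rw [← hfR]
    exact Ring.inverse_unit u
  have hR' : R * fc R g = fc R (polyOn ‖R‖ Polynomial.X) * fc R g := by rw [fc_id hR]
  rw [hu, hR', ← fc_mul hR]
  congr 1
  ext a
  simp [g, hf, resolventOn, div_eq_mul_inv, abs_of_pos hr]

/-- Balakrishnan's formula agrees with the functional calculus. -/
theorem balakrishnan_eq_fc {A : H →ₗ.[𝕜] H} (hR : (boundedInverse A).IsPositive) {σ : ℝ}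
    (h0 : 0 < σ) (h1 : σ < 1) :
    balakrishnan A σ = fc (boundedInverse A) (rpowOn ‖boundedInverse A‖ σ) := by
  have h : ∫ r in Ioi (0 : ℝ), r ^ (-σ) •
      (boundedInverse A * Ring.inverse (1 + r • boundedInverse A))
      = ∫ r in Ioi (0 : ℝ), fc (boundedInverse A)
        (r ^ (-σ) • resolventOn ‖boundedInverse A‖ r) :=
    setIntegral_congr_fun measurableSet_Ioi fun r hr => by
      simp only [map_smul, mul_inverse_eq_fc hR (mem_Ioi.1 hr)]
  rw [balakrishnan, h, ContinuousLinearMap.integral_comp_comm _ (integrableOn_resolventOn _ h0 h1),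
    integral_resolventOn _ h0 h1, map_smul, smul_smul,
    inv_mul_cancel₀ (integral_rpow_div_pos h0 h1).ne',
    one_smul]

theorem negPow_eq_fc {A : H →ₗ.[𝕜] H} (hR : (boundedInverse A).IsPositive) {s : ℝ} (hs : 0 ≤ s) :
    negPow A s = fc (boundedInverse A) (rpowOn ‖boundedInverse A‖ s) := by
  have hfl : ((⌊s⌋₊ : ℕ) : ℝ) + Int.fract s = s := by
    rw [natCast_floor_eq_intCast_floor hs, Int.floor_add_fract]
  have hfr : fc (boundedInverse A) (rpowOn ‖boundedInverse A‖ (Int.fract s))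
      = if Int.fract s = 0 then 1 else balakrishnan A (Int.fract s) := by
    split_ifs with h
    · rw [h, fc_rpowOn_zero hR]
    · rw [balakrishnan_eq_fc hR ((Int.fract_nonneg s).lt_of_ne' h) (Int.fract_lt_one s)]
  rw [negPow, ← hfr, ← fc_rpowOn_natCast hR, ← fc_mul hR,
    ← rpowOn_add _ (Nat.cast_nonneg _) (Int.fract_nonneg s), hfl]

/-! ### Properties of the powers of a positive invertible operator -/

variable {A : H →ₗ.[𝕜] H} (hA : IsPositiveInvertible A)
include hA

theorem IsPositiveInvertible.isBoundedInverse : IsBoundedInverse A (boundedInverse A) := by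
  rw [boundedInverse, dif_pos hA.invertible]
  exact hA.invertible.choose_spec

theorem IsPositiveInvertible.isPositive : (boundedInverse A).IsPositive := by
  have hinv := hA.isBoundedInverse
  have hsymm : A.IsFormalAdjoint A := by
    have := A.adjoint_isFormalAdjoint hA.dense_domain
    rwa [LinearPMap.isSelfAdjoint_def.1 hA.isSelfAdjoint] at this
  refine ⟨fun x y => ?_, fun x => ?_⟩
  · obtain ⟨hx, hx'⟩ := hinv.1 x
    obtain ⟨hy, hy'⟩ := hinv.1 y
    have := hsymm ⟨_, hx⟩ ⟨_, hy⟩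
    rw [hx', hy'] at this
    exact this.symm
  · obtain ⟨hx, hx'⟩ := hinv.1 x
    have := hA.nonneg ⟨_, hx⟩
    rw [hx'] at this
    change 0 ≤ RCLike.re ⟪boundedInverse A x, x⟫_𝕜
    rwa [← inner_conj_symm, RCLike.conj_re]

/-- The split of exponents into integer and fractional part is not additive; the functional
calculus, where powers multiply as functions, removes it. -/
theorem IsPositiveInvertible.negPow_add {s t : ℝ} (hs : 0 ≤ s) (ht : 0 ≤ t) :
    negPow A (s + t) = negPow A s * negPow A t := by
  rw [negPow_eq_fc hA.isPositive hs, negPow_eq_fc hA.isPositive ht,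
    negPow_eq_fc hA.isPositive (add_nonneg hs ht), ← fc_mul hA.isPositive, rpowOn_add _ hs ht]

theorem IsPositiveInvertible.negPow_add_apply {s t : ℝ} (hs : 0 ≤ s) (ht : 0 ≤ t) (x : H) :
    negPow A (s + t) x = negPow A s (negPow A t x) := by
  rw [hA.negPow_add hs ht, mul_apply_eq_comp]

theorem IsPositiveInvertible.inner_negPow {s : ℝ} (hs : 0 ≤ s) (x y : H) :
    ⟪negPow A s x, y⟫_𝕜 = ⟪x, negPow A s y⟫_𝕜 := by
  rw [negPow_eq_fc hA.isPositive hs, inner_fc hA.isPositive]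

omit hA in
theorem negPow_zero : negPow A 0 = 1 := by
  simp [negPow]

omit hA in
theorem negPow_one : negPow A 1 = boundedInverse A := by
  simp [negPow]

theorem IsPositiveInvertible.boundedInverse_injective :
    Function.Injective (boundedInverse A) := by
  intro x y hxy
  obtain ⟨hx, hx'⟩ := hA.isBoundedInverse.1 x
  obtain ⟨hy, hy'⟩ := hA.isBoundedInverse.1 y
  rw [← hx', ← hy']
  congr 1
  exact Subtype.ext hxy

theorem IsPositiveInvertible.mem_domain_iff {x : H} :
    x ∈ A.domain ↔ ∃ y, boundedInverse A y = x :=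
  ⟨fun h => ⟨_, hA.isBoundedInverse.2 ⟨x, h⟩⟩,
    fun ⟨y, hy⟩ => hy ▸ (hA.isBoundedInverse.1 y).1⟩

theorem IsPositiveInvertible.negPow_injective {s : ℝ} (hs : 0 ≤ s) :
    Function.Injective (negPow A s) := by
  obtain ⟨n, hn⟩ := exists_nat_ge s
  -- A^(-s) is a right factor of an injective integer power of A⁻¹.
  have h : negPow A (n - s) * negPow A s = boundedInverse A ^ n := by
    rw [← hA.negPow_add (sub_nonneg.2 hn) hs, sub_add_cancel,
      negPow_eq_fc hA.isPositive (Nat.cast_nonneg n), fc_rpowOn_natCast hA.isPositive]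
  have hinj : ∀ n : ℕ, Function.Injective (boundedInverse A ^ n : H →L[𝕜] H) := by
    intro n
    rw [FunLike.coe_pow_eq_iterate]
    exact hA.boundedInverse_injective.iterate n
  refine Function.Injective.of_comp (f := negPow A (n - s)) ?_
  have := hinj n
  rw [← h] at this
  exact this

theorem IsPositiveInvertible.denseRange_boundedInverse : DenseRange (boundedInverse A) := by
  have : (A.domain : Set H) = range (boundedInverse A) := by
    ext x
    exact hA.mem_domain_iff
  rw [DenseRange, ← this]
  exact hA.dense_domain

theorem IsPositiveInvertible.denseRange_negPow_half : DenseRange (negPow A (1 / 2)) := by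
  refine hA.denseRange_boundedInverse.mono ?_
  rintro _ ⟨x, rfl⟩
  refine ⟨negPow A (1 / 2) x, ?_⟩
  rw [← hA.negPow_add_apply (by norm_num) (by norm_num), add_halves, negPow_one]

end Powers

section Trig

/-! ### The cosine and sine families of the square root -/

/-- With a standing for A⁻¹, cos(tA^(1/2)) corresponds to cos(t/√a), which for t ≠ 0 oscillates at a
= 0. The factor √a, that is A^(-1/2), restores continuity, which is why `rootCos` and `rootSin` are
constructed before `cosOp` and `sinOp`. -/
theorem continuous_sqrt_mul_comp_div {f : ℝ → ℝ} (hf : Continuous f) {C : ℝ} (hC : ∀ x, |f x| ≤ C)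
    (M : ℝ) :
    Continuous fun q : ℝ × Icc (0 : ℝ) M => √(q.2 : ℝ) * f (q.1 / √(q.2 : ℝ)) := by
  rw [continuous_iff_continuousAt]
  intro q
  rcases q.2.2.1.eq_or_lt with h | h
  · have h0 : √(q.2 : ℝ) * f (q.1 / √(q.2 : ℝ)) = 0 := by simp [← h]
    rw [ContinuousAt, h0]
    refine squeeze_zero_norm (a := fun q : ℝ × Icc (0 : ℝ) M => √(q.2 : ℝ) * C) (fun q' => ?_) ?_
    · rw [norm_mul, Real.norm_of_nonneg (Real.sqrt_nonneg _)]
      exact mul_le_mul_of_nonneg_left (hC _) (Real.sqrt_nonneg _)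
    · have hc : Continuous fun q : ℝ × Icc (0 : ℝ) M => √(q.2 : ℝ) * C := by fun_prop
      simpa [← h] using hc.tendsto q
  · have : √(q.2 : ℝ) ≠ 0 := (Real.sqrt_pos.2 h).ne'
    refine ContinuousAt.mul (by fun_prop) (hf.continuousAt.comp ?_)
    exact ContinuousAt.div (by fun_prop) (by fun_prop) this

/-- The function `a ↦ √a cos (t / √a)` on `[0, M]`. -/
def cosOn (M t : ℝ) : C(Icc 0 M, ℝ) where
  toFun a := √(a : ℝ) * Real.cos (t / √(a : ℝ))
  continuous_toFun := (continuous_sqrt_mul_comp_div Real.continuous_cos Real.abs_cos_le_one M).comp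
    (Continuous.prodMk_right t)

/-- The function `a ↦ √a sin (t / √a)` on `[0, M]`. -/
def sinOn (M t : ℝ) : C(Icc 0 M, ℝ) where
  toFun a := √(a : ℝ) * Real.sin (t / √(a : ℝ))
  continuous_toFun := (continuous_sqrt_mul_comp_div Real.continuous_sin Real.abs_sin_le_one M).comp
    (Continuous.prodMk_right t)

theorem continuous_cosOn (M : ℝ) : Continuous (cosOn M) :=
  ContinuousMap.continuous_of_continuous_uncurry _
    (continuous_sqrt_mul_comp_div Real.continuous_cos Real.abs_cos_le_one M)

theorem continuous_sinOn (M : ℝ) : Continuous (sinOn M) :=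
  ContinuousMap.continuous_of_continuous_uncurry _
    (continuous_sqrt_mul_comp_div Real.continuous_sin Real.abs_sin_le_one M)

/-- A family of continuous functions is differentiable in the uniform norm if it is so pointwise
with a uniformly continuous derivative. -/
theorem hasDerivAt_continuousMap {X : Type*} [TopologicalSpace X] [CompactSpace X]
    {F G : ℝ → C(X, ℝ)} (hG : Continuous G) (h : ∀ a t, HasDerivAt (fun r => F r a) (G t a) t)
    (t : ℝ) : HasDerivAt F (G t) t := by
  have hF : F = fun t => F 0 + ∫ r in (0 : ℝ)..t, G r := by
    ext t a
    have h1 := (ContinuousMap.evalCLM ℝ a).intervalIntegral_comp_comm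
      (hG.intervalIntegrable (μ := volume) 0 t)
    change ∫ r in (0 : ℝ)..t, G r a = (∫ r in (0 : ℝ)..t, G r) a at h1
    have h2 := intervalIntegral.integral_eq_sub_of_hasDerivAt (fun r _ => h a r)
      (((ContinuousMap.evalCLM ℝ a).continuous.comp hG).intervalIntegrable (μ := volume) 0 t)
    rw [ContinuousMap.add_apply, ← h1, h2]
    ring
  rw [hF]
  exact (intervalIntegral.integral_hasDerivAt_right (hG.intervalIntegrable 0 t)
    (hG.stronglyMeasurableAtFilter _ _) hG.continuousAt).const_add _

/-- The square root on `[0, M]`. -/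
abbrev sqrtOn (M : ℝ) : C(Icc 0 M, ℝ) := rpowOn M (1 / 2)

theorem sqrtOn_apply (M : ℝ) (a : Icc 0 M) : sqrtOn M a = √(a : ℝ) := by
  rw [sqrtOn, rpowOn_apply _ (by norm_num), Real.sqrt_eq_rpow]

theorem hasDerivAt_sqrtOn_mul_cosOn (M t : ℝ) :
    HasDerivAt (fun r => sqrtOn M * cosOn M r) (-sinOn M t) t := by
  refine hasDerivAt_continuousMap (G := fun t => -sinOn M t) (continuous_sinOn M).neg
    (fun a t => ?_) t
  simp only [ContinuousMap.mul_apply, sqrtOn_apply, ContinuousMap.neg_apply, cosOn, sinOn,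
    ContinuousMap.coe_mk]
  rcases a.2.1.eq_or_lt with h | h
  · simpa [← h] using hasDerivAt_const t (0 : ℝ)
  · have h0 : √(a : ℝ) ≠ 0 := (Real.sqrt_pos.2 h).ne'
    have := (((hasDerivAt_id t).div_const √(a : ℝ)).cos.const_mul √(a : ℝ)).const_mul √(a : ℝ)
    refine this.congr_deriv ?_
    simp only [id]
    field_simp

theorem hasDerivAt_sqrtOn_mul_sinOn (M t : ℝ) :
    HasDerivAt (fun r => sqrtOn M * sinOn M r) (cosOn M t) t := by
  refine hasDerivAt_continuousMap (G := fun t => cosOn M t) (continuous_cosOn M)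
    (fun a t => ?_) t
  simp only [ContinuousMap.mul_apply, sqrtOn_apply, cosOn, sinOn, ContinuousMap.coe_mk]
  rcases a.2.1.eq_or_lt with h | h
  · simpa [← h] using hasDerivAt_const t (0 : ℝ)
  · have h0 : √(a : ℝ) ≠ 0 := (Real.sqrt_pos.2 h).ne'
    have := (((hasDerivAt_id t).div_const √(a : ℝ)).sin.const_mul √(a : ℝ)).const_mul √(a : ℝ)
    refine this.congr_deriv ?_
    simp only [id]
    field_simp

theorem cosOn_sq_add_sinOn_sq (M t : ℝ) :
    cosOn M t * cosOn M t + sinOn M t * sinOn M t = sqrtOn M * sqrtOn M := by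
  ext a
  simp only [ContinuousMap.add_apply, ContinuousMap.mul_apply, sqrtOn_apply, cosOn, sinOn,
    ContinuousMap.coe_mk]
  linear_combination √(a : ℝ) * √(a : ℝ) * Real.cos_sq_add_sin_sq (t / √(a : ℝ))

variable {𝕜 : Type*} [RCLike 𝕜]
  {H : Type*} [NormedAddCommGroup H] [InnerProductSpace 𝕜 H] [CompleteSpace H]
  [NormedSpace ℝ H] [IsScalarTower ℝ 𝕜 H]

/-- The bounded operator `A ^ (-1/2) cos (t A ^ (1/2))`. -/
def rootCos (A : H →ₗ.[𝕜] H) (t : ℝ) : H →L[𝕜] H :=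
  fc (boundedInverse A) (cosOn ‖boundedInverse A‖ t)

/-- The bounded operator `A ^ (-1/2) sin (t A ^ (1/2))`. -/
def rootSin (A : H →ₗ.[𝕜] H) (t : ℝ) : H →L[𝕜] H :=
  fc (boundedInverse A) (sinOn ‖boundedInverse A‖ t)

/-- The bounded operator `cos (t A ^ (1/2))`. -/
def cosOp (A : H →ₗ.[𝕜] H) (t : ℝ) : H →L[𝕜] H :=
  (rootCos A t).toLinearMap.extendOfNorm (negPow A (1 / 2)).toLinearMap

/-- The bounded operator `sin (t A ^ (1/2))`. -/
def sinOp (A : H →ₗ.[𝕜] H) (t : ℝ) : H →L[𝕜] H :=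
  (rootSin A t).toLinearMap.extendOfNorm (negPow A (1 / 2)).toLinearMap

theorem continuous_rootCos (A : H →ₗ.[𝕜] H) : Continuous (rootCos A) :=
  (fc _).continuous.comp (continuous_cosOn _)

theorem continuous_rootSin (A : H →ₗ.[𝕜] H) : Continuous (rootSin A) :=
  (fc _).continuous.comp (continuous_sinOn _)

namespace IsPositiveInvertible

variable {A : H →ₗ.[𝕜] H} (hA : IsPositiveInvertible A)
include hA

theorem negPow_half_eq : negPow A (1 / 2) = fc (boundedInverse A) (sqrtOn ‖boundedInverse A‖) :=
  negPow_eq_fc hA.isPositive (by norm_num)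

/-- This is cos² + sin² = 1 multiplied by A⁻¹. It bounds each summand by ‖A^(-1/2)x‖, so that
A^(-1/2) can be divided out on its dense range to give contractions. -/
theorem norm_sq_rootCos_add_norm_sq_rootSin (t : ℝ) (x : H) :
    ‖rootCos A t x‖ ^ 2 + ‖rootSin A t x‖ ^ 2 = ‖negPow A (1 / 2) x‖ ^ 2 := by
  have h : ∀ f : C(Icc 0 ‖boundedInverse A‖, ℝ), ‖fc (boundedInverse A) f x‖ ^ 2
      = RCLike.re ⟪x, fc (boundedInverse A) (f * f) x⟫_𝕜 := by
    intro f
    rw [fc_mul hA.isPositive, mul_apply_eq_comp, ← inner_fc hA.isPositive,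
      inner_self_eq_norm_sq]
  rw [hA.negPow_half_eq, rootCos, rootSin, h, h, h, ← cosOn_sq_add_sinOn_sq _ t, map_add, add_apply,
    inner_add_right, map_add]

theorem norm_rootCos_le (t : ℝ) (x : H) : ‖rootCos A t x‖ ≤ 1 * ‖negPow A (1 / 2) x‖ := by
  have := hA.norm_sq_rootCos_add_norm_sq_rootSin t x
  rw [one_mul]
  exact le_of_sq_le_sq (by nlinarith [sq_nonneg ‖rootSin A t x‖]) (norm_nonneg _)

theorem norm_rootSin_le (t : ℝ) (x : H) : ‖rootSin A t x‖ ≤ 1 * ‖negPow A (1 / 2) x‖ := by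
  have := hA.norm_sq_rootCos_add_norm_sq_rootSin t x
  rw [one_mul]
  exact le_of_sq_le_sq (by nlinarith [sq_nonneg ‖rootCos A t x‖]) (norm_nonneg _)

theorem cosOp_negPow (t : ℝ) (x : H) : cosOp A t (negPow A (1 / 2) x) = rootCos A t x :=
  LinearMap.extendOfNorm_eq (e := (negPow A (1 / 2)).toLinearMap) hA.denseRange_negPow_half
    ⟨1, hA.norm_rootCos_le t⟩ x

theorem sinOp_negPow (t : ℝ) (x : H) : sinOp A t (negPow A (1 / 2) x) = rootSin A t x :=
  LinearMap.extendOfNorm_eq (e := (negPow A (1 / 2)).toLinearMap) hA.denseRange_negPow_half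
    ⟨1, hA.norm_rootSin_le t⟩ x

theorem norm_cosOp_le (t : ℝ) (x : H) : ‖cosOp A t x‖ ≤ 1 * ‖x‖ :=
  LinearMap.norm_extendOfNorm_apply_le (e := (negPow A (1 / 2)).toLinearMap)
    hA.denseRange_negPow_half 1 (hA.norm_rootCos_le t) x

theorem norm_sinOp_le (t : ℝ) (x : H) : ‖sinOp A t x‖ ≤ 1 * ‖x‖ :=
  LinearMap.norm_extendOfNorm_apply_le (e := (negPow A (1 / 2)).toLinearMap)
    hA.denseRange_negPow_half 1 (hA.norm_rootSin_le t) x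

/-- Two bounded operators agree if they agree after composition with `A ^ (-1/2)`. -/
theorem ext_negPow_half {S S' : H →L[𝕜] H}
    (h : ∀ x, S (negPow A (1 / 2) x) = S' (negPow A (1 / 2) x)) : S = S' :=
  ContinuousLinearMap.coeFn_injective
    (hA.denseRange_negPow_half.equalizer S.continuous S'.continuous (funext h))

theorem fc_comm (f g : C(Icc 0 ‖boundedInverse A‖, ℝ)) (x : H) :
    fc (boundedInverse A) f (fc (boundedInverse A) g x)
      = fc (boundedInverse A) g (fc (boundedInverse A) f x) := by
  rw [← mul_apply_eq_comp, ← fc_mul hA.isPositive, mul_comm, fc_mul hA.isPositive,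
    mul_apply_eq_comp]

theorem negPow_cosOp (t : ℝ) (x : H) : negPow A (1 / 2) (cosOp A t x) = rootCos A t x := by
  refine congrArg (fun S : H →L[𝕜] H => S x)
    (hA.ext_negPow_half (S := negPow A (1 / 2) * cosOp A t) (S' := rootCos A t) fun x => ?_)
  rw [mul_apply_eq_comp, hA.cosOp_negPow, hA.negPow_half_eq, rootCos, hA.fc_comm]

theorem negPow_sinOp (t : ℝ) (x : H) : negPow A (1 / 2) (sinOp A t x) = rootSin A t x := by
  refine congrArg (fun S : H →L[𝕜] H => S x)
    (hA.ext_negPow_half (S := negPow A (1 / 2) * sinOp A t) (S' := rootSin A t) fun x => ?_)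
  rw [mul_apply_eq_comp, hA.sinOp_negPow, hA.negPow_half_eq, rootSin, hA.fc_comm]

theorem negPow_half_injective : Function.Injective (negPow A (1 / 2)) :=
  hA.negPow_injective (by norm_num)

theorem cosOp_sinOp (t : ℝ) (x : H) : cosOp A t (sinOp A t x) = sinOp A t (cosOp A t x) := by
  refine congrArg (fun S : H →L[𝕜] H => S x) (hA.ext_negPow_half
    (S := cosOp A t * sinOp A t) (S' := sinOp A t * cosOp A t) fun x => ?_)
  -- With one factor A^(-1/2) on each side, every product of cosines and sines becomes a product of
  -- `fc` values, which commute.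
  refine hA.negPow_half_injective ?_
  rw [mul_apply_eq_comp, mul_apply_eq_comp, hA.negPow_cosOp, hA.negPow_sinOp, hA.cosOp_negPow,
    hA.sinOp_negPow, rootCos, rootSin, hA.fc_comm]

theorem cosOp_sq_add_sinOp_sq (t : ℝ) (x : H) :
    cosOp A t (cosOp A t x) + sinOp A t (sinOp A t x) = x := by
  refine congrArg (fun S : H →L[𝕜] H => S x) (hA.ext_negPow_half
    (S := cosOp A t * cosOp A t + sinOp A t * sinOp A t) (S' := 1) fun x => ?_)
  refine hA.negPow_half_injective ?_
  rw [add_apply, mul_apply_eq_comp, mul_apply_eq_comp, map_add, hA.negPow_cosOp, hA.negPow_sinOp,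
    hA.cosOp_negPow, hA.sinOp_negPow, hA.negPow_half_eq, rootCos, rootSin, one_apply_eq_self,
    ← mul_apply_eq_comp, ← mul_apply_eq_comp, ← mul_apply_eq_comp, ← add_apply,
    ← fc_mul hA.isPositive,
    ← fc_mul hA.isPositive, ← fc_mul hA.isPositive, ← map_add, cosOn_sq_add_sinOn_sq]

theorem inner_cosOp (t : ℝ) (x y : H) : ⟪cosOp A t x, y⟫_𝕜 = ⟪x, cosOp A t y⟫_𝕜 := by
  induction x, y using hA.denseRange_negPow_half.induction_on₂ with
  | hp => exact isClosed_eq (by fun_prop) (by fun_prop)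
  | h x y =>
    rw [hA.cosOp_negPow, hA.cosOp_negPow, rootCos, ← inner_fc hA.isPositive,
      hA.negPow_half_eq, inner_fc hA.isPositive, inner_fc hA.isPositive,
      inner_fc hA.isPositive, hA.fc_comm]

theorem inner_sinOp (t : ℝ) (x y : H) : ⟪sinOp A t x, y⟫_𝕜 = ⟪x, sinOp A t y⟫_𝕜 := by
  induction x, y using hA.denseRange_negPow_half.induction_on₂ with
  | hp => exact isClosed_eq (by fun_prop) (by fun_prop)
  | h x y =>
    rw [hA.sinOp_negPow, hA.sinOp_negPow, rootSin, ← inner_fc hA.isPositive,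
      hA.negPow_half_eq, inner_fc hA.isPositive, inner_fc hA.isPositive,
      inner_fc hA.isPositive, hA.fc_comm]

omit hA in
/-- A strongly continuous family of contractions is jointly continuous. -/
theorem continuous_uncurry_of_strong {S : ℝ → H →L[𝕜] H} (hS : ∀ t x, ‖S t x‖ ≤ 1 * ‖x‖)
    {Q : H →L[𝕜] H} (hQ : DenseRange Q) (hc : ∀ x, Continuous fun t => S t (Q x)) :
    Continuous fun q : ℝ × H => S q.1 q.2 := by
  refine continuous_prod_of_dense_continuous_lipschitzWith' _ 1 hQ (fun t => ?_) ?_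
  · refine LipschitzWith.of_dist_le_mul fun x y => ?_
    simpa [dist_eq_norm, ← map_sub] using hS t (x - y)
  · rintro _ ⟨x, rfl⟩
    exact hc x

theorem continuous_cosOp : Continuous fun q : ℝ × H => cosOp A q.1 q.2 :=
  continuous_uncurry_of_strong hA.norm_cosOp_le hA.denseRange_negPow_half fun x => by
    simp only [hA.cosOp_negPow]
    exact (continuous_rootCos A).clm_apply continuous_const

theorem continuous_sinOp : Continuous fun q : ℝ × H => sinOp A q.1 q.2 :=
  continuous_uncurry_of_strong hA.norm_sinOp_le hA.denseRange_negPow_half fun x => by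
    simp only [hA.sinOp_negPow]
    exact (continuous_rootSin A).clm_apply continuous_const

/-- Differentiability holds in operator norm because of the two factors A^(-1/2): one absorbs the
A^(1/2) produced by the derivative, the other keeps the derivative a continuous function of A⁻¹. -/
theorem hasDerivAt_rootCos (t : ℝ) :
    HasDerivAt (fun r => negPow A (1 / 2) * rootCos A r) (-rootSin A t) t := by
  have h := (fc (boundedInverse A)).hasFDerivAt.comp_hasDerivAt t
    (hasDerivAt_sqrtOn_mul_cosOn ‖boundedInverse A‖ t)
  rw [map_neg] at h
  refine h.congr_of_eventuallyEq (Filter.Eventually.of_forall fun r => ?_)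
  simp only [Function.comp, fc_mul hA.isPositive, hA.negPow_half_eq, rootCos]

theorem hasDerivAt_rootSin (t : ℝ) :
    HasDerivAt (fun r => negPow A (1 / 2) * rootSin A r) (rootCos A t) t := by
  have h := (fc (boundedInverse A)).hasFDerivAt.comp_hasDerivAt t
    (hasDerivAt_sqrtOn_mul_sinOn ‖boundedInverse A‖ t)
  refine h.congr_of_eventuallyEq (Filter.Eventually.of_forall fun r => ?_)
  simp only [Function.comp, fc_mul hA.isPositive, hA.negPow_half_eq, rootSin]

end IsPositiveInvertible
end Trig

section IntegrationByParts

/-! ### Integration by parts with an integrable derivative -/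

variable {E F : Type*} [NormedAddCommGroup E] [NormedAddCommGroup F]

theorem intervalIntegrable_comp_of_le {f : ℝ × E → F} (hf : Continuous f) {t C : ℝ} (ht : 0 ≤ t)
    (hC : ∀ r ∈ Icc 0 t, ∀ x, ‖f (r, x)‖ ≤ C * ‖x‖) {g : ℝ → E}
    (hg : IntervalIntegrable g volume 0 t) :
    IntervalIntegrable (fun r => f (r, g r)) volume 0 t := by
  rw [intervalIntegrable_iff_integrableOn_Ioc_of_le ht] at *
  refine (hg.norm.const_mul C).mono'
    (hf.comp_aestronglyMeasurable (aestronglyMeasurable_id.prodMk hg.aestronglyMeasurable)) ?_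
  filter_upwards [ae_restrict_mem measurableSet_Ioc] with r hr
  exact hC r ⟨hr.1.le, hr.2⟩ _

theorem integrable_comp_of_le {f : ℝ × E → F} (hf : Continuous f) {C : ℝ}
    (hC : ∀ r x, ‖f (r, x)‖ ≤ C * ‖x‖) {g : ℝ → E} (hg : Integrable g) :
    Integrable fun r => f (r, g r) :=
  (hg.norm.const_mul C).mono'
    (hf.comp_aestronglyMeasurable (aestronglyMeasurable_id.prodMk hg.aestronglyMeasurable))
    (Filter.Eventually.of_forall fun r => hC r _)

variable [NormedSpace ℝ E] [CompleteSpace E] [NormedSpace ℝ F] [CompleteSpace F]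

theorem clm_integral_eq_of_continuous {K K' : ℝ → E →L[ℝ] F} (hK : ∀ t, HasDerivAt K (K' t) t)
    (hK' : Continuous K') {g : ℝ → E} (hg : Continuous g) (t : ℝ) :
    ∫ r in (0 : ℝ)..t, (K' r (∫ s in (0 : ℝ)..r, g s) + K r (g r))
      = K t (∫ s in (0 : ℝ)..t, g s) := by
  have hKc : Continuous K := continuous_iff_continuousAt.2 fun t => (hK t).continuousAt
  have hG : ∀ r, HasDerivAt (fun r => ∫ s in (0 : ℝ)..r, g s) (g r) r := fun r =>
    intervalIntegral.integral_hasDerivAt_right (hg.intervalIntegrable 0 r)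
      (hg.stronglyMeasurableAtFilter _ _) hg.continuousAt
  have hGc : Continuous (fun r => ∫ s in (0 : ℝ)..r, g s) :=
    continuous_iff_continuousAt.2 fun t => (hG t).continuousAt
  rw [intervalIntegral.integral_eq_sub_of_hasDerivAt (fun r _ => (hK r).clm_apply (hG r))
    (((hK'.clm_apply hGc).add (hKc.clm_apply hg)).intervalIntegrable 0 t)]
  simp

/-- For merely integrable g, the product rule is not available at every point. Both sides are linear
in g and controlled by its L¹ norm, so the identity passes from continuous functions to their L¹
limits. -/
theorem clm_integral_eq {K K' : ℝ → E →L[ℝ] F} (hK : ∀ t, HasDerivAt K (K' t) t)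
    (hK' : Continuous K') {g : ℝ → E} {t : ℝ} (ht : 0 ≤ t)
    (hg : IntervalIntegrable g volume 0 t) :
    ∫ r in (0 : ℝ)..t, (K' r (∫ s in (0 : ℝ)..r, g s) + K r (g r))
      = K t (∫ s in (0 : ℝ)..t, g s) := by
  have hKc : Continuous K := continuous_iff_continuousAt.2 fun t => (hK t).continuousAt
  obtain ⟨C, hC0, hC⟩ : ∃ C, 0 ≤ C ∧ ∀ r ∈ Icc 0 t, ‖K r‖ ≤ C ∧ ‖K' r‖ ≤ C := by
    obtain ⟨C₁, h₁⟩ := isCompact_Icc.exists_bound_of_continuousOn (s := Icc 0 t) hKc.continuousOn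
    obtain ⟨C₂, h₂⟩ := isCompact_Icc.exists_bound_of_continuousOn (s := Icc 0 t) hK'.continuousOn
    exact ⟨max C₁ C₂, (norm_nonneg _).trans ((h₁ 0 ⟨le_rfl, ht⟩).trans (le_max_left _ _)),
      fun r hr => ⟨(h₁ r hr).trans (le_max_left _ _), (h₂ r hr).trans (le_max_right _ _)⟩⟩
  have hsub : ∀ r ∈ Icc 0 t, uIcc 0 r ⊆ uIcc 0 t := fun r hr => by
    rw [uIcc_of_le hr.1, uIcc_of_le ht]
    exact Icc_subset_Icc_right hr.2
  have hint : ∀ {u : ℝ → E}, IntervalIntegrable u volume 0 t →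
      IntervalIntegrable (fun r => K' r (∫ s in (0 : ℝ)..r, u s)) volume 0 t ∧
      IntervalIntegrable (fun r => K r (u r)) volume 0 t := by
    intro u hu
    constructor
    · refine ContinuousOn.intervalIntegrable ?_
      refine hK'.continuousOn.clm_apply ?_
      exact intervalIntegral.continuousOn_primitive_interval
        (by rwa [← intervalIntegrable_iff'])
    · exact intervalIntegrable_comp_of_le (f := fun q : ℝ × E => K q.1 q.2)
        ((hKc.comp continuous_fst).clm_apply continuous_snd) ht
        (fun r hr x => (K r).le_of_opNorm_le (hC r hr).1 x) hu
  set δ : (ℝ → E) → F := fun u =>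
    (∫ r in (0 : ℝ)..t, (K' r (∫ s in (0 : ℝ)..r, u s) + K r (u r))) - K t (∫ s in (0 : ℝ)..t, u s)
  have hδ : ∀ u, IntervalIntegrable u volume 0 t →
      ‖δ u‖ ≤ (C * t + 2 * C) * ∫ r in (0 : ℝ)..t, ‖u r‖ := by
    intro u hu
    have hle : ∀ r ∈ Icc 0 t, ‖∫ s in (0 : ℝ)..r, u s‖ ≤ ∫ s in (0 : ℝ)..t, ‖u s‖ := by
      intro r hr
      refine (intervalIntegral.norm_integral_le_integral_norm hr.1).trans ?_
      exact intervalIntegral.integral_mono_interval le_rfl hr.1 hr.2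
        (Filter.Eventually.of_forall fun _ => norm_nonneg _) hu.norm
    have h1 : ‖∫ r in (0 : ℝ)..t, K' r (∫ s in (0 : ℝ)..r, u s)‖
        ≤ C * (∫ s in (0 : ℝ)..t, ‖u s‖) * |t - 0| := by
      refine intervalIntegral.norm_integral_le_of_norm_le_const fun r hr => ?_
      rw [uIoc_of_le ht] at hr
      have hr' : r ∈ Icc 0 t := ⟨hr.1.le, hr.2⟩
      exact ((K' r).le_of_opNorm_le (hC r hr').2 _).trans
        (mul_le_mul_of_nonneg_left (hle r hr') hC0)
    have h2 : ‖∫ r in (0 : ℝ)..t, K r (u r)‖ ≤ C * ∫ s in (0 : ℝ)..t, ‖u s‖ := by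
      rw [← intervalIntegral.integral_const_mul]
      refine (intervalIntegral.norm_integral_le_integral_norm ht).trans ?_
      refine intervalIntegral.integral_mono_on ht (hint hu).2.norm (hu.norm.const_mul C)
        fun r hr => (K r).le_of_opNorm_le (hC r hr).1 _
    have h3 : ‖K t (∫ s in (0 : ℝ)..t, u s)‖ ≤ C * ∫ s in (0 : ℝ)..t, ‖u s‖ :=
      ((K t).le_of_opNorm_le (hC t ⟨ht, le_rfl⟩).1 _).trans
        (mul_le_mul_of_nonneg_left (hle t ⟨ht, le_rfl⟩) hC0)
    simp only [δ]
    rw [intervalIntegral.integral_add (hint hu).1 (hint hu).2]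
    rw [sub_zero, abs_of_nonneg ht] at h1
    refine (norm_sub_le _ _).trans ((add_le_add_left (norm_add_le _ _) _).trans ?_)
    linarith
  rw [← sub_eq_zero, ← norm_le_zero_iff]
  change ‖δ g‖ ≤ 0
  refine le_of_forall_pos_le_add fun ε hε => ?_
  -- The added 1 keeps the divisor positive when C = 0.
  have hpos : 0 < C * t + 2 * C + 1 := by positivity
  obtain ⟨h, -, hle, hcont, -⟩ := Integrable.exists_hasCompactSupport_integral_sub_le
    ((intervalIntegrable_iff_integrableOn_Ioc_of_le ht).1 hg) (div_pos hε hpos)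
  rw [← intervalIntegral.integral_of_le ht] at hle
  have hh : IntervalIntegrable h volume 0 t := hcont.intervalIntegrable 0 t
  have hsubδ : δ g = δ (fun r => g r - h r) := by
    have h0 : δ h = 0 := sub_eq_zero.2 (clm_integral_eq_of_continuous hK hK' hcont t)
    rw [← sub_zero (δ g), ← h0]
    simp only [δ]
    rw [intervalIntegral.integral_sub hg hh, map_sub, sub_sub_sub_comm,
      ← intervalIntegral.integral_sub ((hint hg).1.add (hint hg).2) ((hint hh).1.add (hint hh).2)]
    congr 1
    refine intervalIntegral.integral_congr fun r hr => ?_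
    rw [uIcc_of_le ht] at hr
    rw [intervalIntegral.integral_sub (hg.mono_set (hsub r hr)) (hh.mono_set (hsub r hr)), map_sub,
      map_sub]
    abel
  rw [hsubδ, zero_add]
  refine (hδ _ (hg.sub hh)).trans ?_
  have hnn : 0 ≤ ∫ r in (0 : ℝ)..t, ‖g r - h r‖ :=
    intervalIntegral.integral_nonneg ht fun _ _ => norm_nonneg _
  calc (C * t + 2 * C) * ∫ r in (0 : ℝ)..t, ‖g r - h r‖
      ≤ (C * t + 2 * C + 1) * ∫ r in (0 : ℝ)..t, ‖g r - h r‖ :=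
        mul_le_mul_of_nonneg_right (by linarith) hnn
    _ ≤ (C * t + 2 * C + 1) * (ε / (C * t + 2 * C + 1)) := by gcongr
    _ = ε := by field_simp

/-- Integration by parts for `K X`, where `K` is a `C¹` family of operators and `X` is the
primitive of an integrable function. -/
theorem clm_apply_eq_add_integral {𝕜 : Type*} [RCLike 𝕜] {H : Type*} [NormedAddCommGroup H]
    [NormedSpace 𝕜 H] [CompleteSpace H] [NormedSpace ℝ H] [IsScalarTower ℝ 𝕜 H]
    {K K' : ℝ → H →L[𝕜] H} (hK : ∀ t, HasDerivAt K (K' t) t)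
    (hK' : Continuous K') {X ξ : ℝ → H} {X₀ : H} {t : ℝ} (ht : 0 ≤ t)
    (hξ : IntervalIntegrable ξ volume 0 t)
    (hX : ∀ r ∈ Icc 0 t, X r = X₀ + ∫ s in (0 : ℝ)..r, ξ s) :
    IntervalIntegrable (fun r => K' r (X r) + K r (ξ r)) volume 0 t ∧
    K t (X t) = K 0 X₀ + ∫ r in (0 : ℝ)..t, (K' r (X r) + K r (ξ r)) := by
  have hKc : Continuous K := continuous_iff_continuousAt.2 fun t => (hK t).continuousAt
  have hXc : ContinuousOn X (uIcc 0 t) := by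
    have := intervalIntegral.continuousOn_primitive_interval
      (f := ξ) (μ := volume) (a := 0) (b := t) (by rwa [← intervalIntegrable_iff'])
    exact (this.const_add X₀).congr fun r hr => hX r (by rwa [uIcc_of_le ht] at hr)
  obtain ⟨C, hC⟩ := isCompact_Icc.exists_bound_of_continuousOn (s := Icc 0 t) hKc.continuousOn
  have i1 : IntervalIntegrable (fun r => K' r (X r)) volume 0 t :=
    (hK'.continuousOn.clm_apply hXc).intervalIntegrable
  have i2 : IntervalIntegrable (fun r => K r (ξ r)) volume 0 t :=
    intervalIntegrable_comp_of_le (f := fun q : ℝ × H => K q.1 q.2)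
      ((hKc.comp continuous_fst).clm_apply continuous_snd) ht
      (fun r hr x => (K r).le_of_opNorm_le (hC r hr) x) hξ
  refine ⟨i1.add i2, ?_⟩
  set ρ := ContinuousLinearMap.restrictScalarsL 𝕜 H H ℝ ℝ
  have h1 := clm_integral_eq (K := fun r => ρ (K r)) (K' := fun r => ρ (K' r))
    (fun t => ρ.hasFDerivAt.comp_hasDerivAt t (hK t)) (ρ.continuous.comp hK') ht hξ
  change ∫ r in (0 : ℝ)..t, (K' r (∫ s in (0 : ℝ)..r, ξ s) + K r (ξ r))
      = K t (∫ s in (0 : ℝ)..t, ξ s) at h1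
  have h2 := intervalIntegral.integral_eq_sub_of_hasDerivAt
    (f := fun r => K r X₀) (f' := fun r => K' r X₀) (a := 0) (b := t)
    (fun r _ => (ρ.hasFDerivAt.comp_hasDerivAt r (hK r)).clm_apply (hasDerivAt_const r X₀)
      |>.congr_deriv (by simp [ρ]))
    ((hK'.clm_apply continuous_const).intervalIntegrable 0 t)
  have h3 : ∫ r in (0 : ℝ)..t, (K' r (X r) + K r (ξ r))
      = ∫ r in (0 : ℝ)..t, (K' r X₀ + (K' r (∫ s in (0 : ℝ)..r, ξ s) + K r (ξ r))) := by
    refine intervalIntegral.integral_congr fun r hr => ?_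
    rw [uIcc_of_le ht] at hr
    rw [hX r hr, map_add, add_assoc]
  have i3 : IntervalIntegrable (fun r => K' r (∫ s in (0 : ℝ)..r, ξ s)) volume 0 t :=
    (hK'.continuousOn.clm_apply (intervalIntegral.continuousOn_primitive_interval
      (by rwa [← intervalIntegrable_iff']))).intervalIntegrable
  rw [h3, intervalIntegral.integral_add ((hK'.clm_apply continuous_const).intervalIntegrable 0 t)
    (i3.add i2), h1, h2, hX t ⟨ht, le_rfl⟩, map_add]
  abel

end IntegrationByParts

section System

/-! ### The first-order system -/

variable {𝕜 : Type*} [RCLike 𝕜]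
  {H : Type*} [NormedAddCommGroup H] [InnerProductSpace 𝕜 H] [CompleteSpace H]
  [NormedSpace ℝ H] [IsScalarTower ℝ 𝕜 H]

namespace IsPositiveInvertible

variable {A : H →ₗ.[𝕜] H} (hA : IsPositiveInvertible A)
include hA

theorem cosOp_negPow_comm (t : ℝ) (x : H) :
    cosOp A t (negPow A (1 / 2) x) = negPow A (1 / 2) (cosOp A t x) := by
  rw [hA.cosOp_negPow, hA.negPow_cosOp]

theorem sinOp_negPow_comm (t : ℝ) (x : H) :
    sinOp A t (negPow A (1 / 2) x) = negPow A (1 / 2) (sinOp A t x) := by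
  rw [hA.sinOp_negPow, hA.negPow_sinOp]

theorem cosOp_zero (x : H) : cosOp A 0 x = x := by
  refine hA.negPow_half_injective ?_
  rw [hA.negPow_cosOp, hA.negPow_half_eq, rootCos]
  congr 2
  ext a
  simp [cosOn, sqrtOn_apply]

theorem sinOp_zero (x : H) : sinOp A 0 x = 0 := by
  refine hA.negPow_half_injective ?_
  rw [hA.negPow_sinOp, rootSin, map_zero]
  have : sinOn ‖boundedInverse A‖ 0 = 0 := by
    ext a
    simp [sinOn]
  rw [this, map_zero, zero_apply]

theorem intervalIntegrable_cosOp {g : ℝ → H} {t : ℝ} (ht : 0 ≤ t)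
    (hg : IntervalIntegrable g volume 0 t) :
    IntervalIntegrable (fun r => cosOp A r (g r)) volume 0 t :=
  intervalIntegrable_comp_of_le hA.continuous_cosOp ht (fun r _ x => hA.norm_cosOp_le r x) hg

theorem intervalIntegrable_sinOp {g : ℝ → H} {t : ℝ} (ht : 0 ≤ t)
    (hg : IntervalIntegrable g volume 0 t) :
    IntervalIntegrable (fun r => sinOp A r (g r)) volume 0 t :=
  intervalIntegrable_comp_of_le hA.continuous_sinOp ht (fun r _ x => hA.norm_sinOp_le r x) hg

omit hA in
theorem clm_integral_comm (S : H →L[𝕜] H) {f : ℝ → H} {t : ℝ}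
    (hf : IntervalIntegrable f volume 0 t) :
    ∫ r in (0 : ℝ)..t, S (f r) = S (∫ r in (0 : ℝ)..t, f r) :=
  (S.restrictScalars ℝ).intervalIntegral_comp_comm hf

/-- Integration by parts against `A ^ (-1) cos (t A ^ (1/2))`. -/
theorem cosOp_apply_eq {X ξ : ℝ → H} {X₀ : H} {t : ℝ} (ht : 0 ≤ t)
    (hξ : IntervalIntegrable ξ volume 0 t)
    (hX : ∀ r ∈ Icc 0 t, X r = X₀ + ∫ s in (0 : ℝ)..r, ξ s) :
    IntervalIntegrable (fun r => -negPow A (1 / 2) (sinOp A r (X r))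
      + negPow A (1 / 2) (negPow A (1 / 2) (cosOp A r (ξ r)))) volume 0 t ∧
    negPow A (1 / 2) (negPow A (1 / 2) (cosOp A t (X t)))
      = negPow A (1 / 2) (negPow A (1 / 2) X₀)
        + ∫ r in (0 : ℝ)..t, (-negPow A (1 / 2) (sinOp A r (X r))
          + negPow A (1 / 2) (negPow A (1 / 2) (cosOp A r (ξ r)))) := by
  have := clm_apply_eq_add_integral hA.hasDerivAt_rootCos (continuous_rootSin A).neg ht hξ hX
  simpa only [mul_apply_eq_comp, neg_apply, ← hA.negPow_cosOp, ← hA.negPow_sinOp,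
    hA.cosOp_zero] using this

/-- Integration by parts against `A ^ (-1) sin (t A ^ (1/2))`. -/
theorem sinOp_apply_eq {X ξ : ℝ → H} {X₀ : H} {t : ℝ} (ht : 0 ≤ t)
    (hξ : IntervalIntegrable ξ volume 0 t)
    (hX : ∀ r ∈ Icc 0 t, X r = X₀ + ∫ s in (0 : ℝ)..r, ξ s) :
    IntervalIntegrable (fun r => negPow A (1 / 2) (cosOp A r (X r))
      + negPow A (1 / 2) (negPow A (1 / 2) (sinOp A r (ξ r)))) volume 0 t ∧
    negPow A (1 / 2) (negPow A (1 / 2) (sinOp A t (X t)))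
      = ∫ r in (0 : ℝ)..t, (negPow A (1 / 2) (cosOp A r (X r))
          + negPow A (1 / 2) (negPow A (1 / 2) (sinOp A r (ξ r)))) := by
  have := clm_apply_eq_add_integral hA.hasDerivAt_rootSin (continuous_rootCos A) ht hξ hX
  simpa only [mul_apply_eq_comp, ← hA.negPow_cosOp, ← hA.negPow_sinOp,
    hA.sinOp_zero, map_zero, zero_add] using this

/-- The solution of the system `A ^ (-1/2) x' = y`, `A ^ (-1/2) y' = -x + A ^ (-1/2) g` is given by
variation of constants. -/
theorem system_unique {g x y : ℝ → H} {x₀ y₀ : H}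
    (hg : ∀ t, 0 ≤ t → IntervalIntegrable g volume 0 t)
    (hx : ContinuousOn x (Ici 0)) (hy : ContinuousOn y (Ici 0))
    (hX : ∀ t, 0 ≤ t → negPow A (1 / 2) (x t) = negPow A (1 / 2) x₀ + ∫ r in (0 : ℝ)..t, y r)
    (hY : ∀ t, 0 ≤ t → negPow A (1 / 2) (y t) = negPow A (1 / 2) y₀
      + ∫ r in (0 : ℝ)..t, (-x r + negPow A (1 / 2) (g r))) {t : ℝ} (ht : 0 ≤ t) :
    cosOp A t (x t) - sinOp A t (y t) = x₀ - ∫ r in (0 : ℝ)..t, sinOp A r (g r) ∧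
    sinOp A t (x t) + cosOp A t (y t) = y₀ + ∫ r in (0 : ℝ)..t, cosOp A r (g r) := by
  have hsub : uIcc 0 t ⊆ Ici 0 := by
    rw [uIcc_of_le ht]
    exact Icc_subset_Ici_self
  have iy : IntervalIntegrable y volume 0 t := (hy.mono hsub).intervalIntegrable
  have ix : IntervalIntegrable x volume 0 t := (hx.mono hsub).intervalIntegrable
  have ig : IntervalIntegrable (fun r => negPow A (1 / 2) (g r)) volume 0 t :=
    ⟨((negPow A (1 / 2)).restrictScalars ℝ).integrable_comp (hg t ht).1,
      ((negPow A (1 / 2)).restrictScalars ℝ).integrable_comp (hg t ht).2⟩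
  have ixg : IntervalIntegrable (fun r => -x r + negPow A (1 / 2) (g r)) volume 0 t := ix.neg.add ig
  have hX' := fun r (hr : r ∈ Icc 0 t) => hX r hr.1
  have hY' := fun r (hr : r ∈ Icc 0 t) => hY r hr.1
  obtain ⟨ic1, c1⟩ := hA.cosOp_apply_eq ht iy hX'
  obtain ⟨ic2, c2⟩ := hA.cosOp_apply_eq ht ixg hY'
  obtain ⟨is1, s1⟩ := hA.sinOp_apply_eq ht iy hX'
  obtain ⟨is2, s2⟩ := hA.sinOp_apply_eq ht ixg hY'
  have isg := hA.intervalIntegrable_sinOp ht (hg t ht)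
  have icg := hA.intervalIntegrable_cosOp ht (hg t ht)
  set Q := negPow A (1 / 2)
  -- Integration by parts costs two factors A^(-1/2), and the equations for x and y carry a third.
  -- After multiplication by A^(-3/2), the terms in x and y cancel and only the forcing g remains.
  set S : H →L[𝕜] H := Q * (Q * Q)
  constructor
  · have e : (∫ r in (0 : ℝ)..t, (-Q (sinOp A r (Q (x r))) + Q (Q (cosOp A r (y r)))))
        - ∫ r in (0 : ℝ)..t, (Q (cosOp A r (Q (y r))) + Q (Q (sinOp A r (-x r + Q (g r)))))
        = -S (∫ r in (0 : ℝ)..t, sinOp A r (g r)) := by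
      rw [← intervalIntegral.integral_sub ic1 is2, ← clm_integral_comm S isg,
        ← intervalIntegral.integral_neg]
      congr 1
      funext r
      simp only [S, mul_apply_eq_comp, map_add, map_neg, Q, hA.cosOp_negPow_comm,
        hA.sinOp_negPow_comm]
      abel
    refine hA.negPow_half_injective (hA.negPow_half_injective (hA.negPow_half_injective ?_))
    change S _ = S _
    have h := congrArg₂ (· - ·) c1 s2
    simp only [add_sub_assoc] at h
    rw [e] at h
    rw [map_sub, map_sub, sub_eq_add_neg _ (S (∫ _ in _.._, _))]
    simpa only [S, mul_apply_eq_comp, Q, hA.cosOp_negPow_comm, hA.sinOp_negPow_comm] using h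
  · have e : (∫ r in (0 : ℝ)..t, (Q (cosOp A r (Q (x r))) + Q (Q (sinOp A r (y r)))))
        + ∫ r in (0 : ℝ)..t, (-Q (sinOp A r (Q (y r))) + Q (Q (cosOp A r (-x r + Q (g r)))))
        = S (∫ r in (0 : ℝ)..t, cosOp A r (g r)) := by
      rw [← intervalIntegral.integral_add is1 ic2, ← clm_integral_comm S icg]
      congr 1
      funext r
      simp only [S, mul_apply_eq_comp, map_add, map_neg, Q, hA.cosOp_negPow_comm,
        hA.sinOp_negPow_comm]
      abel
    refine hA.negPow_half_injective (hA.negPow_half_injective (hA.negPow_half_injective ?_))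
    change S _ = S _
    have h := congrArg₂ (· + ·) s1 c2
    simp only [add_left_comm _ (Q (Q (Q y₀)))] at h
    rw [e] at h
    rw [map_add, map_add]
    simpa only [S, mul_apply_eq_comp, Q, hA.cosOp_negPow_comm, hA.sinOp_negPow_comm] using h

omit hA in
/-- The position component of the variation of constants formula. -/
def varConstPos (A : H →ₗ.[𝕜] H) (g : ℝ → H) (x₀ y₀ : H) (t : ℝ) : H :=
  cosOp A t (x₀ - ∫ r in (0 : ℝ)..t, sinOp A r (g r))
    + sinOp A t (y₀ + ∫ r in (0 : ℝ)..t, cosOp A r (g r))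

omit hA in
/-- The velocity component of the variation of constants formula. -/
def varConstVel (A : H →ₗ.[𝕜] H) (g : ℝ → H) (x₀ y₀ : H) (t : ℝ) : H :=
  -sinOp A t (x₀ - ∫ r in (0 : ℝ)..t, sinOp A r (g r))
    + cosOp A t (y₀ + ∫ r in (0 : ℝ)..t, cosOp A r (g r))

theorem varConstPos_zero (g : ℝ → H) (x₀ y₀ : H) : varConstPos A g x₀ y₀ 0 = x₀ := by
  simp [varConstPos, hA.cosOp_zero, hA.sinOp_zero]

theorem varConstVel_zero (g : ℝ → H) (x₀ y₀ : H) : varConstVel A g x₀ y₀ 0 = y₀ := by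
  simp [varConstVel, hA.cosOp_zero, hA.sinOp_zero]

theorem integrable_cosOp {g : ℝ → H} (hg : Integrable g) :
    Integrable fun r => cosOp A r (g r) :=
  integrable_comp_of_le (f := fun q : ℝ × H => cosOp A q.1 q.2) hA.continuous_cosOp
    hA.norm_cosOp_le hg

theorem integrable_sinOp {g : ℝ → H} (hg : Integrable g) :
    Integrable fun r => sinOp A r (g r) :=
  integrable_comp_of_le (f := fun q : ℝ × H => sinOp A q.1 q.2) hA.continuous_sinOp
    hA.norm_sinOp_le hg

theorem continuous_cosOp_apply {h : ℝ → H} (hh : Continuous h) :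
    Continuous fun t => cosOp A t (h t) := by
  have := hA.continuous_cosOp.comp (continuous_id.prodMk hh)
  exact this

theorem continuous_sinOp_apply {h : ℝ → H} (hh : Continuous h) :
    Continuous fun t => sinOp A t (h t) := by
  have := hA.continuous_sinOp.comp (continuous_id.prodMk hh)
  exact this

theorem continuous_sub_integral_sinOp {g : ℝ → H} (hg : Integrable g) (x₀ : H) :
    Continuous fun t => x₀ - ∫ r in (0 : ℝ)..t, sinOp A r (g r) :=
  continuous_const.sub (intervalIntegral.continuous_primitive
    (fun _ _ => (hA.integrable_sinOp hg).intervalIntegrable) 0)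

theorem continuous_add_integral_cosOp {g : ℝ → H} (hg : Integrable g) (y₀ : H) :
    Continuous fun t => y₀ + ∫ r in (0 : ℝ)..t, cosOp A r (g r) :=
  continuous_const.add (intervalIntegral.continuous_primitive
    (fun _ _ => (hA.integrable_cosOp hg).intervalIntegrable) 0)

theorem continuous_varConstPos {g : ℝ → H} (hg : Integrable g) (x₀ y₀ : H) :
    Continuous (varConstPos A g x₀ y₀) :=
  (hA.continuous_cosOp_apply (hA.continuous_sub_integral_sinOp hg x₀)).add
    (hA.continuous_sinOp_apply (hA.continuous_add_integral_cosOp hg y₀))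

theorem continuous_varConstVel {g : ℝ → H} (hg : Integrable g) (x₀ y₀ : H) :
    Continuous (varConstVel A g x₀ y₀) :=
  (hA.continuous_sinOp_apply (hA.continuous_sub_integral_sinOp hg x₀)).neg.add
    (hA.continuous_cosOp_apply (hA.continuous_add_integral_cosOp hg y₀))

/-- The variation of constants formula solves the system `A ^ (-1/2) x' = y`,
`A ^ (-1/2) y' = -x + A ^ (-1/2) g`. -/
theorem system_exists {g : ℝ → H} (hg : Integrable g) (x₀ y₀ : H) {t : ℝ} (ht : 0 ≤ t) :
    negPow A (1 / 2) (varConstPos A g x₀ y₀ t)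
      = negPow A (1 / 2) x₀ + ∫ r in (0 : ℝ)..t, varConstVel A g x₀ y₀ r ∧
    negPow A (1 / 2) (varConstVel A g x₀ y₀ t) = negPow A (1 / 2) y₀
      + ∫ r in (0 : ℝ)..t, (-varConstPos A g x₀ y₀ r + negPow A (1 / 2) (g r)) := by
  have ig : IntervalIntegrable g volume 0 t := hg.intervalIntegrable
  have isg := hA.intervalIntegrable_sinOp ht ig
  have icg := hA.intervalIntegrable_cosOp ht ig
  have hX : ∀ r ∈ Icc 0 t, x₀ - ∫ s in (0 : ℝ)..r, sinOp A s (g s)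
      = x₀ + ∫ s in (0 : ℝ)..r, -sinOp A s (g s) := fun r _ => by
    rw [intervalIntegral.integral_neg, sub_eq_add_neg]
  have insg : IntervalIntegrable (fun r => -sinOp A r (g r)) volume 0 t := isg.neg
  obtain ⟨ic1, c1⟩ := hA.cosOp_apply_eq ht insg hX
  obtain ⟨ic2, c2⟩ := hA.cosOp_apply_eq (X₀ := y₀) ht icg (fun r _ => rfl)
  obtain ⟨is1, s1⟩ := hA.sinOp_apply_eq ht insg hX
  obtain ⟨is2, s2⟩ := hA.sinOp_apply_eq (X₀ := y₀) ht icg (fun r _ => rfl)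
  set Q := negPow A (1 / 2)
  have iV : IntervalIntegrable (varConstVel A g x₀ y₀) volume 0 t :=
    (hA.continuous_varConstVel hg x₀ y₀).intervalIntegrable 0 t
  have iP : IntervalIntegrable (fun r => -varConstPos A g x₀ y₀ r + Q (g r)) volume 0 t :=
    ((hA.continuous_varConstPos hg x₀ y₀).neg.intervalIntegrable 0 t).add
      ((Q.restrictScalars ℝ).integrable_comp hg).intervalIntegrable
  constructor
  · refine hA.negPow_half_injective ?_
    change Q _ = Q _
    rw [map_add, ← clm_integral_comm Q iV, varConstPos, map_add, map_add, c1, s2, add_assoc,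
      ← intervalIntegral.integral_add ic1 is2]
    congr 2
    funext r
    simp only [varConstVel, map_add, map_neg, hA.cosOp_sinOp]
    abel
  · refine hA.negPow_half_injective ?_
    change Q _ = Q _
    rw [map_add, ← clm_integral_comm Q iP, varConstVel, map_add, map_add, map_neg, map_neg, s1, c2,
      add_left_comm, neg_add_eq_sub, ← intervalIntegral.integral_sub ic2 is1]
    congr 2
    funext r
    -- The derivatives of the two integrals contribute sin²g + cos²g = g to the velocity; for the
    -- position the corresponding terms sin cos g and cos sin g cancel.
    conv_rhs => rw [← hA.cosOp_sq_add_sinOp_sq r (g r)]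
    simp only [varConstPos, map_add, map_neg, map_sub]
    abel

end IsPositiveInvertible
end System

section Scales

/-! ### The scale of spaces in terms of the bounded powers -/

variable {𝕜 : Type*} [RCLike 𝕜]
  {H : Type*} [NormedAddCommGroup H] [InnerProductSpace 𝕜 H] [CompleteSpace H]
  [NormedSpace ℝ H] [IsScalarTower ℝ 𝕜 H]
  {U : Type*} [NormedAddCommGroup U] [InnerProductSpace 𝕜 U] [CompleteSpace U]

theorem mem_pow_domain_of_nonpos (A : H →ₗ.[𝕜] H) {s : ℝ} (hs : s ≤ 0) (x : H) :
    ∃ h : x ∈ (pow A s).domain, pow A s ⟨x, h⟩ = negPow A (-s) x := by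
  rw [pow, if_pos hs]
  exact ⟨trivial, rfl⟩

namespace IsPositiveInvertible

variable {A : H →ₗ.[𝕜] H} (hA : IsPositiveInvertible A)
include hA

theorem mem_pow_domain_iff {s : ℝ} (hs : 0 < s) {x : H} :
    x ∈ (pow A s).domain ↔ ∃ y, negPow A s y = x := by
  rw [pow, if_neg hs.not_ge, LinearPMap.inverse_domain]
  constructor
  · rintro ⟨⟨y, _⟩, hy⟩
    exact ⟨y, hy⟩
  · rintro ⟨y, hy⟩
    exact ⟨⟨y, trivial⟩, hy⟩

theorem pow_negPow {s : ℝ} (hs : 0 < s) (y : H) :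
    ∃ h : negPow A s y ∈ (pow A s).domain, pow A s ⟨negPow A s y, h⟩ = y := by
  refine ⟨(hA.mem_pow_domain_iff hs).2 ⟨y, rfl⟩, ?_⟩
  have hp : pow A s = (((negPow A s : H →L[𝕜] H) : H →ₗ[𝕜] H).toPMap ⊤).inverse := by
    rw [pow, if_neg hs.not_ge]
  -- Generalising over P allows substitution although the membership proof depends on the domain.
  have key : ∀ (P : H →ₗ.[𝕜] H),
      P = (((negPow A s : H →L[𝕜] H) : H →ₗ[𝕜] H).toPMap ⊤).inverse →
      ∀ h : negPow A s y ∈ P.domain, P ⟨negPow A s y, h⟩ = y := by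
    rintro _ rfl h
    refine LinearPMap.inverse_apply_eq
      (f := (((negPow A s : H →L[𝕜] H) : H →ₗ[𝕜] H).toPMap ⊤)) ?_ (x := ⟨y, trivial⟩) rfl
    rw [LinearMap.ker_eq_bot]
    intro a b hab
    exact Subtype.ext (hA.negPow_injective hs.le hab)
  exact key _ hp _

/-- All data will be written as A^(-t)y with t large enough, so that every norm in the scale, of
either sign, becomes the norm of a bounded operator applied to y. -/
theorem scaleNorm_negPow {s t : ℝ} (ht : 0 ≤ t) (hst : s ≤ t) (y : H) :
    scaleNorm A s (negPow A t y) = ‖negPow A (t - s) y‖ₑ := by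
  rcases le_or_gt s 0 with hs | hs
  · obtain ⟨h, h'⟩ := mem_pow_domain_of_nonpos A hs (negPow A t y)
    rw [scaleNorm, dif_pos h, h', ← hA.negPow_add_apply (neg_nonneg.2 hs) ht, neg_add_eq_sub]
  · have he : negPow A t y = negPow A s (negPow A (t - s) y) := by
      rw [← hA.negPow_add_apply hs.le (sub_nonneg.2 hst), add_sub_cancel]
    obtain ⟨h, h'⟩ := hA.pow_negPow hs (negPow A (t - s) y)
    rw [he, scaleNorm, dif_pos h, h']

/-- The isometric isomorphism `A ^ (1/2) : H_{1/2} → H`. -/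
def scaleIso : Scale A (1 / 2) ≃ₗᵢ[𝕜] H where
  toLinearEquiv := LinearEquiv.ofBijective (Scale.powMap A (1 / 2)) (by
    constructor
    · rintro ⟨x, hx⟩ ⟨y, hy⟩ hxy
      obtain ⟨a, rfl⟩ := (hA.mem_pow_domain_iff (by norm_num)).1 hx
      obtain ⟨b, rfl⟩ := (hA.mem_pow_domain_iff (by norm_num)).1 hy
      obtain ⟨_, ha⟩ := hA.pow_negPow (s := 1 / 2) (by norm_num) a
      obtain ⟨_, hb⟩ := hA.pow_negPow (s := 1 / 2) (by norm_num) b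
      have : a = b := by
        rw [← ha, ← hb]
        exact hxy
      subst this
      rfl
    · intro y
      obtain ⟨h, hy⟩ := hA.pow_negPow (s := 1 / 2) (by norm_num) y
      exact ⟨⟨_, h⟩, hy⟩)
  norm_map' _ := rfl

theorem scaleIso_apply (ψ : Scale A (1 / 2)) : hA.scaleIso ψ = Scale.powL A (1 / 2) ψ := rfl

theorem incl_eq (ψ : Scale A (1 / 2)) :
    Scale.incl A (1 / 2) ψ = negPow A (1 / 2) (hA.scaleIso ψ) := by
  obtain ⟨x, hx⟩ := ψ
  obtain ⟨a, rfl⟩ := (hA.mem_pow_domain_iff (by norm_num)).1 hx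
  obtain ⟨_, ha⟩ := hA.pow_negPow (s := 1 / 2) (by norm_num) a
  have : hA.scaleIso ⟨_, hx⟩ = a := ha
  rw [this]
  rfl

/-- The isometric isomorphism `A ^ (1/2) : H → H_{-1/2}`. -/
def dualIso : H ≃ₗᵢ[𝕜] NegScale A (1 / 2) where
  toLinearEquiv := LinearEquiv.ofBijective
    { toFun := fun h => ((innerSL 𝕜).flip h).comp (Scale.powL A (1 / 2))
      map_add' := fun a b => by ext ψ; simp
      map_smul' := fun c a => by ext ψ; simp } (by
    constructor
    · intro a b hab
      refine ext_inner_left 𝕜 fun y => ?_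
      have := DFunLike.congr_fun hab (hA.scaleIso.symm y)
      simpa [← hA.scaleIso_apply] using this
    · intro w
      -- Conjugating the conjugate-linear w and transporting it along A^(-1/2) gives a linear
      -- functional on H, to which Riesz applies.
      set f : H →L[𝕜] 𝕜 := ((starL 𝕜 : 𝕜 ≃L⋆[𝕜] 𝕜) : 𝕜 →L⋆[𝕜] 𝕜).comp
        (w.comp (hA.scaleIso.symm.toContinuousLinearEquiv : H →L[𝕜] Scale A (1 / 2)))
      refine ⟨(InnerProductSpace.toDual 𝕜 H).symm f, ?_⟩
      ext ψ
      change ⟪Scale.powL A (1 / 2) ψ, (InnerProductSpace.toDual 𝕜 H).symm f⟫_𝕜 = w ψ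
      rw [← inner_conj_symm, InnerProductSpace.toDual_symm_apply, ← hA.scaleIso_apply]
      simp [f])
  norm_map' h := by
    refine le_antisymm (ContinuousLinearMap.opNorm_le_bound _ (norm_nonneg _) fun ψ => ?_) ?_
    · refine (norm_inner_le_norm (𝕜 := 𝕜) (Scale.powL A (1 / 2) ψ) h).trans ?_
      rw [mul_comm]
      rfl
    · rcases eq_or_ne h 0 with rfl | hne
      · simp
      refine le_of_mul_le_mul_right ?_ (norm_pos_iff.2 hne)
      have := ContinuousLinearMap.le_opNorm
        (((innerSL 𝕜).flip h).comp (Scale.powL A (1 / 2)) : NegScale A (1 / 2))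
        (hA.scaleIso.symm h)
      rw [LinearIsometryEquiv.norm_map] at this
      refine le_trans ?_ this
      simp [← hA.scaleIso_apply, inner_self_eq_norm_sq_to_K, pow_two]

theorem dualIso_apply (h : H) (ψ : Scale A (1 / 2)) :
    hA.dualIso h ψ = ⟪hA.scaleIso ψ, h⟫_𝕜 := rfl

theorem extA_eq (Z : Scale A (1 / 2)) : extA A Z = hA.dualIso (hA.scaleIso Z) := rfl

theorem isOfPivot_iff (w : NegScale A (1 / 2)) (z : H) :
    w.IsOfPivot z ↔ w = hA.dualIso (negPow A (1 / 2) z) := by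
  rw [NegScale.IsOfPivot, ContinuousLinearMap.ext_iff]
  refine forall_congr' fun ψ => ?_
  rw [hA.dualIso_apply, hA.incl_eq, hA.inner_negPow (by norm_num)]

/-- The bounded operator `A ^ (-1/2) B : U → H`. -/
def rootB (B : U →L[𝕜] NegScale A (1 / 2)) : U →L[𝕜] H :=
  (hA.dualIso.symm.toContinuousLinearEquiv : NegScale A (1 / 2) →L[𝕜] H).comp B

theorem dualIso_rootB (B : U →L[𝕜] NegScale A (1 / 2)) (u : U) :
    hA.dualIso (hA.rootB B u) = B u :=
  hA.dualIso.apply_symm_apply _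

theorem adjointOp_eq (B : U →L[𝕜] NegScale A (1 / 2)) (ψ : Scale A (1 / 2)) :
    adjointOp B ψ = (hA.rootB B).adjoint (hA.scaleIso ψ) := by
  refine ext_inner_right 𝕜 fun u => ?_
  rw [inner_adjointOp, ContinuousLinearMap.adjoint_inner_left, ← hA.dualIso_apply,
    hA.dualIso_rootB]

end IsPositiveInvertible
end Scales

section Solutions

/-! ### Free and controlled solutions -/

variable {𝕜 : Type*} [RCLike 𝕜]
  {H : Type*} [NormedAddCommGroup H] [InnerProductSpace 𝕜 H] [CompleteSpace H]
  [NormedSpace ℝ H] [IsScalarTower ℝ 𝕜 H]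
  {U : Type*} [NormedAddCommGroup U] [InnerProductSpace 𝕜 U] [CompleteSpace U]

theorem eq_add_integral_of_hasDerivWithinAt_Ici {E : Type*} [NormedAddCommGroup E]
    [NormedSpace ℝ E] [CompleteSpace E] {f f' : ℝ → E} (hf' : ContinuousOn f' (Ici 0))
    (h : ∀ t ∈ Ici (0 : ℝ), HasDerivWithinAt f (f' t) (Ici 0) t) {t : ℝ} (ht : 0 ≤ t) :
    f t = f 0 + ∫ r in (0 : ℝ)..t, f' r := by
  have hc : ContinuousOn f (Icc 0 t) := fun r hr =>
    (h r hr.1).continuousWithinAt.mono Icc_subset_Ici_self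
  rw [intervalIntegral.integral_eq_sub_of_hasDeriv_right_of_le ht hc
    (fun r hr => (h r hr.1.le).mono fun s hs => hr.1.le.trans (le_of_lt hs))
    ((hf'.mono (by rw [uIcc_of_le ht]; exact Icc_subset_Ici_self)).intervalIntegrable)]
  abel

theorem hasDerivWithinAt_Ici_of_eq_add_integral {E : Type*} [NormedAddCommGroup E]
    [NormedSpace ℝ E] [CompleteSpace E] {f f' : ℝ → E} {f₀ : E} (hf' : Continuous f')
    (h : ∀ t, 0 ≤ t → f t = f₀ + ∫ r in (0 : ℝ)..t, f' r) {t : ℝ} (ht : 0 ≤ t) :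
    HasDerivWithinAt f (f' t) (Ici 0) t := by
  have h1 : HasDerivAt (fun t => f₀ + ∫ r in (0 : ℝ)..t, f' r) (f' t) t :=
    (intervalIntegral.integral_hasDerivAt_right (hf'.intervalIntegrable 0 t)
      (hf'.stronglyMeasurableAtFilter _ _) hf'.continuousAt).const_add _
  exact h1.hasDerivWithinAt.congr (fun s hs => h s hs) (h t ht)

namespace IsPositiveInvertible

variable {A : H →ₗ.[𝕜] H} (hA : IsPositiveInvertible A)
include hA

theorem negPow_half_negPow_half (x : H) :
    negPow A (1 / 2) (negPow A (1 / 2) x) = boundedInverse A x := by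
  rw [← hA.negPow_add_apply (by norm_num) (by norm_num), add_halves, negPow_one]

omit hA in
theorem integral_neg_add_clm (S : H →L[𝕜] H) {u g : ℝ → H} {t : ℝ}
    (hu : IntervalIntegrable u volume 0 t) (hg : Integrable g) :
    ∫ r in (0 : ℝ)..t, (-u r + S (g r))
      = -(∫ r in (0 : ℝ)..t, u r) + S (∫ r in (0 : ℝ)..t, g r) := by
  have i1 : IntervalIntegrable (fun r => -u r) volume 0 t := hu.neg
  have i2 : IntervalIntegrable (fun r => S (g r)) volume 0 t :=
    ((S.restrictScalars ℝ).integrable_comp hg).intervalIntegrable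
  rw [intervalIntegral.integral_add i1 i2, intervalIntegral.integral_neg,
    clm_integral_comm S hg.intervalIntegrable]

/-- Every free solution is given by the cosine and sine families. -/
theorem scaleIso_of_isFreeSolution {z₀ z₁ : H} {φ φ' : ℝ → Scale A (1 / 2)}
    (h : IsFreeSolution A z₀ z₁ φ φ') :
    ∃ a b, boundedInverse A a = z₀ ∧ negPow A (1 / 2) b = z₁ ∧
      ∀ t, 0 ≤ t → hA.scaleIso (φ t) = negPow A (1 / 2) (cosOp A t a + sinOp A t b) := by
  obtain ⟨p, hp, hp'⟩ := h.eqn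
  -- The pair p = Aφ, q = A^(1/2)φ' solves the first-order system with g = 0.
  set q : ℝ → H := fun t => hA.scaleIso (φ' t)
  have hq : ContinuousOn q (Ici 0) := hA.scaleIso.continuous.comp_continuousOn h.continuousOn_vel
  have hRp : ∀ t, 0 ≤ t → boundedInverse A (p t) = Scale.incl A _ (φ t) := by
    intro t ht
    obtain ⟨hd, he⟩ := (hp' t ht).1
    rw [← he]
    exact hA.isBoundedInverse.2 ⟨_, hd⟩
  have hQp : ∀ t, 0 ≤ t → negPow A (1 / 2) (p t) = hA.scaleIso (φ t) := by
    intro t ht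
    refine hA.negPow_half_injective ?_
    rw [hA.negPow_half_negPow_half, hRp t ht, hA.incl_eq]
  have iq : ∀ t, 0 ≤ t → IntervalIntegrable q volume 0 t := fun t ht =>
    (hq.mono (by rw [uIcc_of_le ht]; exact Icc_subset_Ici_self)).intervalIntegrable
  have hX : ∀ t, 0 ≤ t → negPow A (1 / 2) (p t)
      = negPow A (1 / 2) (p 0) + ∫ r in (0 : ℝ)..t, q r := by
    intro t ht
    refine hA.negPow_half_injective ?_
    have := eq_add_integral_of_hasDerivWithinAt_Ici
      (f' := fun t => negPow A (1 / 2) (q t))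
      ((negPow A (1 / 2)).continuous.comp_continuousOn hq)
      (fun t ht => by simpa only [hA.incl_eq] using h.hasDeriv t ht) ht
    rw [map_add, ← clm_integral_comm _ (iq t ht), hQp t ht, hQp 0 le_rfl]
    exact this
  have hY : ∀ t, 0 ≤ t → negPow A (1 / 2) (q t)
      = negPow A (1 / 2) (q 0) + ∫ r in (0 : ℝ)..t, (-p r + negPow A (1 / 2) ((0 : ℝ → H) r)) := by
    intro t ht
    have := eq_add_integral_of_hasDerivWithinAt_Ici (f' := fun t => -p t) hp.neg
      (fun t ht => by simpa only [hA.incl_eq] using (hp' t ht).2) ht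
    simpa using this
  refine ⟨p 0, q 0, ?_, ?_, fun t ht => ?_⟩
  · rw [hRp 0 le_rfl, h.init]
  · rw [← hA.incl_eq, h.init_vel]
  · obtain ⟨h1, h2⟩ := hA.system_unique (g := 0)
      (fun t _ => (integrable_zero ℝ H volume).intervalIntegrable) hp hq hX hY ht
    simp only [Pi.zero_apply, map_zero, intervalIntegral.integral_zero, sub_zero, add_zero] at h1 h2
    rw [← hQp t ht, ← h1, ← h2]
    congr 1
    conv_lhs => rw [← hA.cosOp_sq_add_sinOp_sq t (p t)]
    simp only [map_add, map_sub, hA.cosOp_sinOp]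
    abel

/-- Observability is quantified over all free solutions; existence keeps it from being vacuous for
any data. The solution is A⁻¹p with velocity A^(-1/2)q, where (p,q) rotates (a,b). -/
theorem exists_isFreeSolution (a b : H) :
    ∃ φ φ', IsFreeSolution A (boundedInverse A a) (negPow A (1 / 2) b) φ φ' := by
  have hX := fun t (ht : 0 ≤ t) => (hA.system_exists (g := 0) (integrable_zero ℝ H volume) a b ht).1
  have hY := fun t (ht : 0 ≤ t) => (hA.system_exists (g := 0) (integrable_zero ℝ H volume) a b ht).2
  set p := varConstPos A 0 a b
  set q := varConstVel A 0 a b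
  have hp : Continuous p := hA.continuous_varConstPos (integrable_zero ℝ H volume) a b
  have hq : Continuous q := hA.continuous_varConstVel (integrable_zero ℝ H volume) a b
  have hp0 : p 0 = a := hA.varConstPos_zero _ a b
  have hq0 : q 0 = b := hA.varConstVel_zero _ a b
  have hY' : ∀ t, 0 ≤ t → negPow A (1 / 2) (q t) = negPow A (1 / 2) b + ∫ r in (0 : ℝ)..t, -p r :=
    fun t ht => by simpa using hY t ht
  refine ⟨fun t => hA.scaleIso.symm (negPow A (1 / 2) (p t)), fun t => hA.scaleIso.symm (q t), ?_⟩
  refine ⟨?_, ?_, ?_, fun t ht => ?_, p, hp.continuousOn, fun t ht => ⟨?_, ?_⟩⟩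
  · rw [hA.incl_eq, LinearIsometryEquiv.apply_symm_apply, hA.negPow_half_negPow_half, hp0]
  · rw [hA.incl_eq, LinearIsometryEquiv.apply_symm_apply, hq0]
  · exact (hA.scaleIso.symm.continuous.comp hq).continuousOn
  · simp only [hA.incl_eq, LinearIsometryEquiv.apply_symm_apply]
    have := hasDerivWithinAt_Ici_of_eq_add_integral hq hX ht
    exact ((negPow A (1 / 2)).restrictScalars ℝ).hasFDerivAt.comp_hasDerivWithinAt t this
  · rw [hA.incl_eq, LinearIsometryEquiv.apply_symm_apply, hA.negPow_half_negPow_half]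
    exact hA.isBoundedInverse.1 (p t)
  · simp only [hA.incl_eq, LinearIsometryEquiv.apply_symm_apply]
    exact hasDerivWithinAt_Ici_of_eq_add_integral hp.neg hY' ht

/-- A control steers the data to rest in time `T` if and only if its moments against the
cosine and sine families are those of the data. -/
theorem exists_isControlledSolution_iff (B : U →L[𝕜] NegScale A (1 / 2)) (z₀ z₁ : H) {v : ℝ → U}
    (hv : Integrable v) {T : ℝ} (hT : 0 < T) (hvT : ∀ t, T < t → v t = 0) :
    (∃ z w, IsControlledSolution B z₀ z₁ v z w ∧ ∀ t, T ≤ t → z t = 0) ↔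
      ∫ r in (0 : ℝ)..T, sinOp A r (hA.rootB B (v r)) = z₀ ∧
      ∫ r in (0 : ℝ)..T, cosOp A r (hA.rootB B (v r)) = -negPow A (1 / 2) z₁ := by
  set g : ℝ → H := fun r => hA.rootB B (v r)
  have hg : Integrable g := (hA.rootB B).integrable_comp hv
  set Q := negPow A (1 / 2)
  set E : H →L[ℝ] NegScale A (1 / 2) :=
    (hA.dualIso.toContinuousLinearEquiv : H →L[𝕜] NegScale A (1 / 2)).restrictScalars ℝ
  have hE : ∀ h, E h = hA.dualIso h := fun _ => rfl
  have : CompleteSpace (NegScale A (1 / 2)) :=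
    (completeSpace_congr (e := hA.dualIso.toEquiv)
      hA.dualIso.toContinuousLinearEquiv.isUniformEmbedding).1 inferInstance
  have hBg : ∀ t, ∫ r in (0 : ℝ)..t, B (v r) = E (∫ r in (0 : ℝ)..t, g r) := by
    intro t
    rw [← E.intervalIntegral_comp_comm hg.intervalIntegrable]
    simp only [hE, g, hA.dualIso_rootB]
  constructor
  · rintro ⟨z, w, h, hz⟩
    -- With y = A^(-1/2)z' and g = A^(-1/2)Bv, the pair (z, y) solves the first-order system in H.
    set y : ℝ → H := fun t => hA.dualIso.symm (w t)
    have hw : ∀ t, w t = E (y t) := fun t => (hA.dualIso.apply_symm_apply _).symm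
    have hy : ContinuousOn y (Ici 0) :=
      hA.dualIso.symm.continuous.comp_continuousOn h.continuousOn_vel
    obtain ⟨ι, hι⟩ := h.hasDeriv
    have hy0 : y 0 = Q z₁ := by
      have := (hA.isOfPivot_iff _ _).1 h.init_vel
      simp [y, this, Q]
    have hder : ∀ t ∈ Ici (0 : ℝ), HasDerivWithinAt (fun t => Q (z t)) (y t) (Ici 0) t := by
      intro t ht
      have h1 := (((hA.dualIso.symm.toContinuousLinearEquiv :
        NegScale A (1 / 2) →L[𝕜] H).restrictScalars ℝ).hasFDerivAt.comp_hasDerivWithinAt t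
        (hι t ht).2)
      refine h1.congr_of_mem (fun s hs => ?_) ht
      change _ = hA.dualIso.symm (ι s)
      rw [(hA.isOfPivot_iff _ _).1 (hι s hs).1, LinearIsometryEquiv.symm_apply_apply]
    have hX : ∀ t, 0 ≤ t → Q (z t) = Q z₀ + ∫ r in (0 : ℝ)..t, y r := fun t ht => by
      rw [← h.init]
      exact eq_add_integral_of_hasDerivWithinAt_Ici hy hder ht
    have hY : ∀ t, 0 ≤ t → Q (y t) = Q (Q z₁) + ∫ r in (0 : ℝ)..t, (-z r + Q (g r)) := by
      intro t ht
      obtain ⟨Z, hZ, he⟩ := h.eqn t ht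
      rw [hBg, hw, hw, hA.extA_eq, ← hE, ← map_sub, ← map_add] at he
      have he' := congrArg Q (hA.dualIso.injective he)
      have iz : IntervalIntegrable z volume 0 t := (h.continuousOn.mono (by
        rw [uIcc_of_le ht]; exact Icc_subset_Ici_self)).intervalIntegrable
      rw [map_add, map_sub, ← hA.incl_eq, hZ, hy0] at he'
      rw [integral_neg_add_clm Q iz hg, ← he']
      abel
    -- Only z is required to vanish after T; the velocity at T vanishes as the one-sided derivative
    -- of a function constant on [T, ∞).
    have hyT : y T = 0 := by
      have h1 := (hder T hT.le).mono (Ici_subset_Ici.2 hT.le)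
      have h2 : HasDerivWithinAt (fun t => Q (z t)) 0 (Ici T) T :=
        (hasDerivWithinAt_const T _ (0 : H)).congr_of_mem
          (fun s hs => by simp [hz s hs]) self_mem_Ici
      exact (uniqueDiffWithinAt_Ici T).eq_deriv _ h1 h2
    obtain ⟨h1, h2⟩ := hA.system_unique (fun t _ => hg.intervalIntegrable) h.continuousOn hy hX hY
      hT.le
    rw [hz T le_rfl, hyT, map_zero, map_zero, sub_zero] at h1
    rw [hz T le_rfl, hyT, map_zero, map_zero, add_zero] at h2
    exact ⟨(sub_eq_zero.1 h1.symm).symm, (neg_eq_of_add_eq_zero_right h2.symm).symm⟩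
  · rintro ⟨h1, h2⟩
    have hX := fun t (ht : 0 ≤ t) => (hA.system_exists hg z₀ (Q z₁) ht).1
    have hY := fun t (ht : 0 ≤ t) => (hA.system_exists hg z₀ (Q z₁) ht).2
    have hx0 := hA.varConstPos_zero g z₀ (Q z₁)
    have hy0 := hA.varConstVel_zero g z₀ (Q z₁)
    have hx := hA.continuous_varConstPos hg z₀ (Q z₁)
    have hy := hA.continuous_varConstVel hg z₀ (Q z₁)
    refine ⟨varConstPos A g z₀ (Q z₁), fun t => E (varConstVel A g z₀ (Q z₁) t),
      ⟨hx.continuousOn, (E.continuous.comp hy).continuousOn, hx0, ?_,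
        ⟨fun t => E (Q (varConstPos A g z₀ (Q z₁) t)), fun t ht => ⟨?_, ?_⟩⟩, fun t ht => ?_⟩, ?_⟩
    · rw [hA.isOfPivot_iff, hy0]
      rfl
    · rw [hA.isOfPivot_iff]
      rfl
    · exact E.hasFDerivAt.comp_hasDerivWithinAt t
        (hasDerivWithinAt_Ici_of_eq_add_integral hy hX ht)
    -- The equation forces this value of A^(1/2)Z; the system then identifies Z with ∫z.
    · refine ⟨hA.scaleIso.symm (Q z₁ - varConstVel A g z₀ (Q z₁) t + ∫ r in (0 : ℝ)..t, g r),
        ?_, ?_⟩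
      · rw [hA.incl_eq, LinearIsometryEquiv.apply_symm_apply, map_add, map_sub]
        change Q _ - Q _ + Q _ = _
        rw [hY t ht, integral_neg_add_clm _ (hx.intervalIntegrable 0 t) hg]
        abel
      · rw [hA.extA_eq, LinearIsometryEquiv.apply_symm_apply, hBg, ← hE, hy0, ← map_sub, ← map_add]
        congr 1
        abel
    · intro t ht
      -- After T the control is zero, so the integrals keep their values at T, and the moment
      -- conditions annihilate both brackets of the variation of constants formula.
      have hext : ∀ f : ℝ → H, (∀ r, T < r → f r = 0) →
          ∫ r in (0 : ℝ)..t, f r = ∫ r in (0 : ℝ)..T, f r := by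
        intro f hf
        rw [intervalIntegral.integral_of_le (hT.le.trans ht), intervalIntegral.integral_of_le hT.le]
        refine (setIntegral_eq_of_subset_of_forall_sdiff_eq_zero measurableSet_Ioc
          (Ioc_subset_Ioc_right ht) fun r hr => hf r ?_)
        by_contra hrT
        exact hr.2 ⟨hr.1.1, not_lt.1 hrT⟩
      rw [varConstPos, hext _ fun r hr => by simp [g, hvT r hr],
        hext _ fun r hr => by simp [g, hvT r hr], h1, h2]
      simp

end IsPositiveInvertible
end Solutions

section Duality

/-! ### Duality between observation and control -/

variable {𝕜 : Type*} [RCLike 𝕜]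

/-- A linear functional which is bounded by `K ‖Λ x‖` is represented by a vector of norm at most
`K` through `Λ`. -/
theorem exists_inner_eq_of_norm_le {X E : Type*} [AddCommGroup X] [Module 𝕜 X]
    [NormedAddCommGroup E] [InnerProductSpace 𝕜 E] [CompleteSpace E] (Λ : X →ₗ[𝕜] E)
    (ℓ : X →ₗ[𝕜] 𝕜) {K : ℝ} (hK : 0 ≤ K) (h : ∀ x, ‖ℓ x‖ ≤ K * ‖Λ x‖) :
    ∃ v : E, ‖v‖ ≤ K ∧ ∀ x, ⟪v, Λ x⟫_𝕜 = ℓ x := by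
  -- The bound makes ℓ vanish on the kernel of Λ, so it factors through the range. That range need
  -- not be closed, hence Hahn–Banach below.
  have hf : ∀ x, ℓ.compLeftInverse Λ ⟨Λ x, LinearMap.mem_range_self Λ x⟩ = ℓ x := fun x =>
    LinearMap.compLeftInverse_apply_of_bdd _ _ ⟨K, h⟩ _ _ rfl
  obtain ⟨g, hg, hn⟩ := exists_extension_norm_eq (LinearMap.range Λ) (ℓ.compLeftInverse Λ)
  refine ⟨(InnerProductSpace.toDual 𝕜 E).symm g, ?_, fun x => ?_⟩
  · rw [LinearIsometryEquiv.norm_map, hn]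
    refine ContinuousLinearMap.opNorm_le_bound _ hK ?_
    rintro ⟨_, x, rfl⟩
    rw [hf]
    exact h x
  · rw [InnerProductSpace.toDual_symm_apply, ← hf x]
    exact hg ⟨Λ x, LinearMap.mem_range_self Λ x⟩

theorem enorm_toLp_two_sq {Ω E : Type*} [MeasurableSpace Ω] {μ : Measure Ω}
    [NormedAddCommGroup E] {f : Ω → E} (hf : MemLp f 2 μ) :
    ‖hf.toLp f‖ₑ ^ 2 = ∫⁻ x, ‖f x‖ₑ ^ 2 ∂μ := by
  have := eLpNorm_nnreal_pow_eq_lintegral (f := f) (μ := μ) (p := 2) two_ne_zero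
  have h2 : ((2 : NNReal) : ℝ) = ((2 : ℕ) : ℝ) := by norm_num
  simp only [h2, ENNReal.rpow_natCast, ENNReal.coe_ofNat] at this
  rw [Lp.enorm_toLp, this]

theorem enorm_sq_eq_ofReal {E : Type*} [SeminormedAddCommGroup E] (x : E) :
    ‖x‖ₑ ^ 2 = ENNReal.ofReal (‖x‖ ^ 2) := by
  rw [← ofReal_norm, ENNReal.ofReal_pow (norm_nonneg _)]

theorem ofReal_mul_enorm_sq_add {E F : Type*} [SeminormedAddCommGroup E]
    [SeminormedAddCommGroup F] {C : ℝ} (hC : 0 ≤ C) (x : E) (y : F) :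
    ENNReal.ofReal C * (‖x‖ₑ ^ 2 + ‖y‖ₑ ^ 2) = ENNReal.ofReal (C * (‖x‖ ^ 2 + ‖y‖ ^ 2)) := by
  rw [enorm_sq_eq_ofReal, enorm_sq_eq_ofReal, ← ENNReal.ofReal_add (by positivity) (by positivity),
    ← ENNReal.ofReal_mul hC]

theorem norm_inner_add_inner_sq_le {E : Type*} [NormedAddCommGroup E] [InnerProductSpace 𝕜 E]
    (x y x' y' : E) :
    ‖⟪x, x'⟫_𝕜 + ⟪y, y'⟫_𝕜‖ ^ 2 ≤ (‖x‖ ^ 2 + ‖y‖ ^ 2) * (‖x'‖ ^ 2 + ‖y'‖ ^ 2) := by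
  have h : ‖⟪x, x'⟫_𝕜 + ⟪y, y'⟫_𝕜‖ ≤ ‖x‖ * ‖x'‖ + ‖y‖ * ‖y'‖ :=
    (norm_add_le _ _).trans (add_le_add (norm_inner_le_norm _ _) (norm_inner_le_norm _ _))
  calc _ ≤ (‖x‖ * ‖x'‖ + ‖y‖ * ‖y'‖) ^ 2 := by gcongr
    _ ≤ _ := by nlinarith [sq_nonneg (‖x‖ * ‖y'‖ - ‖y‖ * ‖x'‖)]

variable {H : Type*} [NormedAddCommGroup H] [InnerProductSpace 𝕜 H] [CompleteSpace H]
  [NormedSpace ℝ H] [IsScalarTower ℝ 𝕜 H]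
  {U : Type*} [NormedAddCommGroup U] [InnerProductSpace 𝕜 U] [CompleteSpace U]

namespace IsPositiveInvertible

variable {A : H →ₗ.[𝕜] H} (hA : IsPositiveInvertible A) (B : U →L[𝕜] NegScale A (1 / 2))
include hA

/-- The output `B* φ(t)` of the free solution with data `(A ^ (-1) a, A ^ (-1/2) b)`. -/
def output (a b : H) (t : ℝ) : U :=
  (hA.rootB B).adjoint (negPow A (1 / 2) (cosOp A t a + sinOp A t b))

theorem continuous_output (a b : H) : Continuous (hA.output B a b) :=
  ((hA.rootB B).adjoint.continuous.comp (negPow A (1 / 2)).continuous).comp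
    ((hA.continuous_cosOp_apply continuous_const).add
      (hA.continuous_sinOp_apply continuous_const))

theorem memLp_output (a b : H) (T : ℝ) :
    MemLp (hA.output B a b) 2 (volume.restrict (Icc 0 T)) := by
  obtain ⟨C, hC⟩ := (isCompact_Icc (a := (0 : ℝ)) (b := T)).exists_bound_of_continuousOn
    (hA.continuous_output B a b).continuousOn
  refine MemLp.of_bound (hA.continuous_output B a b).aestronglyMeasurable C ?_
  filter_upwards [ae_restrict_mem measurableSet_Icc] with t ht
  exact hC t ht

/-- The output map into `L²(0,T;U)`. -/
def outputMap (T : ℝ) : H × H →ₗ[𝕜] Lp U 2 (volume.restrict (Icc (0 : ℝ) T)) where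
  toFun q := (hA.memLp_output B q.1 q.2 T).toLp _
  map_add' q q' := by
    rw [← MemLp.toLp_add]
    congr 1
    funext t
    simp only [output, Prod.fst_add, Prod.snd_add, map_add, Pi.add_apply]
    abel
  map_smul' c q := by
    rw [RingHom.id_apply, ← MemLp.toLp_const_smul]
    congr 1
    funext t
    simp only [output, Prod.smul_fst, Prod.smul_snd, map_smul, Pi.smul_apply, map_add, smul_add]

/-- Cosine, sine and A^(-1/2) are self-adjoint and commute, so moving them and the adjoint of
A^(-1/2)B across the inner product turns the pairing into the two moments of the control. -/
theorem inner_outputMap {T : ℝ} (hT : 0 < T) {v : ℝ → U}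
    (hv : MemLp v 2 (volume.restrict (Icc (0 : ℝ) T))) (a b : H) :
    ⟪hA.outputMap B T (a, b), hv.toLp v⟫_𝕜
      = ⟪negPow A (1 / 2) a,
          ∫ r in (0 : ℝ)..T, cosOp A r (hA.rootB B ((Icc 0 T).indicator v r))⟫_𝕜
        + ⟪negPow A (1 / 2) b,
          ∫ r in (0 : ℝ)..T, sinOp A r (hA.rootB B ((Icc 0 T).indicator v r))⟫_𝕜 := by
  have hvi : Integrable ((Icc 0 T).indicator v) :=
    (integrable_indicator_iff measurableSet_Icc).2 (hv.integrable one_le_two)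
  have hg : Integrable fun r => hA.rootB B ((Icc 0 T).indicator v r) :=
    (hA.rootB B).integrable_comp hvi
  have ic := hA.integrable_cosOp hg
  have is := hA.integrable_sinOp hg
  have hi : ∀ (x : H) {f : ℝ → H}, Integrable f →
      IntervalIntegrable (fun r => ⟪x, f r⟫_𝕜) volume 0 T ∧
      ⟪x, ∫ r in (0 : ℝ)..T, f r⟫_𝕜 = ∫ r in (0 : ℝ)..T, ⟪x, f r⟫_𝕜 := fun x f hf =>
    ⟨(((innerSL 𝕜 x).restrictScalars ℝ).integrable_comp hf).intervalIntegrable,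
      (((innerSL 𝕜 x).restrictScalars ℝ).intervalIntegral_comp_comm hf.intervalIntegrable).symm⟩
  rw [(hi _ ic).2, (hi _ is).2, ← intervalIntegral.integral_add (hi _ ic).1 (hi _ is).1,
    intervalIntegral.integral_of_le hT.le, ← integral_Icc_eq_integral_Ioc, L2.inner_def]
  refine integral_congr_ae ?_
  filter_upwards [(hA.memLp_output B a b T).coeFn_toLp, hv.coeFn_toLp,
    ae_restrict_mem measurableSet_Icc] with t h1 h2 ht
  rw [indicator_of_mem ht, h2]
  change ⟪(hA.memLp_output B a b T).toLp _ t, v t⟫_𝕜 = _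
  rw [h1, output, ContinuousLinearMap.adjoint_inner_left, map_add, inner_add_left,
    ← hA.cosOp_negPow_comm, ← hA.sinOp_negPow_comm, hA.inner_cosOp, hA.inner_sinOp]

/-- Weak observability in terms of the output map. -/
theorem isWeaklyObservable_iff {α T : ℝ} (hα : -(1 / 2) < α) :
    IsWeaklyObservable B α T ↔ ∃ C : ℝ, 0 < C ∧ ∀ a b,
      C * (‖negPow A (α + 1) a‖ ^ 2 + ‖negPow A (α + 1) b‖ ^ 2)
        ≤ ‖hA.outputMap B T (a, b)‖ ^ 2 := by
  have hint : ∀ a b (φ : ℝ → Scale A (1 / 2)),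
      (∀ t, 0 ≤ t → hA.scaleIso (φ t) = negPow A (1 / 2) (cosOp A t a + sinOp A t b)) →
      ∫⁻ t in Icc 0 T, ‖adjointOp B (φ t)‖ₑ ^ 2
        = ENNReal.ofReal (‖hA.outputMap B T (a, b)‖ ^ 2) := by
    intro a b φ hφ
    rw [← enorm_sq_eq_ofReal]
    change _ = ‖(hA.memLp_output B a b T).toLp _‖ₑ ^ 2
    rw [enorm_toLp_two_sq]
    refine setLIntegral_congr_fun measurableSet_Icc fun t ht => ?_
    simp only [hA.adjointOp_eq, hφ t ht.1, output]
  have hnorm : ∀ {C : ℝ}, 0 < C → ∀ a b,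
      -- Both exponents become α + 1, as 1 - (-α) and as 1/2 - (-α - 1/2).
      ENNReal.ofReal C * (scaleNorm A (-α) (boundedInverse A a) ^ 2
        + scaleNorm A (-α - 1 / 2) (negPow A (1 / 2) b) ^ 2)
      = ENNReal.ofReal (C * (‖negPow A (α + 1) a‖ ^ 2 + ‖negPow A (α + 1) b‖ ^ 2)) := by
    intro C hC a b
    rw [← negPow_one, hA.scaleNorm_negPow zero_le_one (by linarith),
      hA.scaleNorm_negPow (by norm_num) (by linarith), ofReal_mul_enorm_sq_add hC.le]
    ring_nf
  refine exists_congr fun C => and_congr_right fun hC => ⟨fun h a b => ?_, ?_⟩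
  · obtain ⟨φ, φ', hφ⟩ := hA.exists_isFreeSolution a b
    obtain ⟨a', b', ha, hb, hab⟩ := hA.scaleIso_of_isFreeSolution hφ
    rw [hA.boundedInverse_injective ha, hA.negPow_half_injective hb] at hab
    have := h _ (hA.mem_domain_iff.2 ⟨a, rfl⟩) _
      ((hA.mem_pow_domain_iff (by norm_num)).2 ⟨b, rfl⟩) φ φ' hφ
    rw [hint a b φ hab, hnorm hC] at this
    exact (ENNReal.ofReal_le_ofReal_iff (by positivity)).1 this
  · intro h z₀ _ z₁ _ φ φ' hφ
    obtain ⟨a, b, rfl, rfl, hab⟩ := hA.scaleIso_of_isFreeSolution hφ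
    rw [hint a b φ hab, hnorm hC]
    exact ENNReal.ofReal_le_ofReal (h a b)

/-- The data `(z₀, z₁)` can be steered to rest in time `T` by the control `v`, extended by zero. -/
theorem exists_isControlledSolution_indicator_iff {T : ℝ} (hT : 0 < T) {v : ℝ → U}
    (hv : MemLp v 2 (volume.restrict (Icc (0 : ℝ) T))) (z₀ z₁ : H) :
    (∃ z w, IsControlledSolution B z₀ z₁ ((Icc 0 T).indicator v) z w ∧ ∀ t, T ≤ t → z t = 0) ↔
      ∀ a b, ⟪hA.outputMap B T (a, b), hv.toLp v⟫_𝕜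
        = ⟪negPow A (1 / 2) a, -negPow A (1 / 2) z₁⟫_𝕜 + ⟪negPow A (1 / 2) b, z₀⟫_𝕜 := by
  have hvi : Integrable ((Icc 0 T).indicator v) :=
    (integrable_indicator_iff measurableSet_Icc).2 (hv.integrable one_le_two)
  rw [hA.exists_isControlledSolution_iff B z₀ z₁ hvi hT
    fun t ht => indicator_of_notMem (fun h => h.2.not_gt ht) _]
  simp only [hA.inner_outputMap B hT hv]
  refine ⟨fun ⟨h1, h2⟩ a b => by rw [h1, h2], fun h => ⟨?_, ?_⟩⟩
  · refine hA.negPow_half_injective (ext_inner_left 𝕜 fun b => ?_)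
    rw [← hA.inner_negPow (by norm_num), ← hA.inner_negPow (by norm_num)]
    simpa using h 0 b
  · refine hA.negPow_half_injective (ext_inner_left 𝕜 fun a => ?_)
    rw [← hA.inner_negPow (by norm_num), ← hA.inner_negPow (by norm_num)]
    simpa using h a 0

/-- The vector ζ is A^α z. Since α + 1/2 > 0, the identity A^(-1/2)z = A^(-α-1/2)ζ involves bounded
powers only, whatever the sign of α. -/
theorem exists_negPow_eq_of_mem_pow_domain {α : ℝ} (hα : -(1 / 2) < α) {z : H}
    (hz : z ∈ (pow A α).domain) :
    ∃ ζ, scaleNorm A α z = ‖ζ‖ₑ ∧ negPow A (1 / 2) z = negPow A (α + 1 / 2) ζ := by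
  rcases le_or_gt α 0 with h | h
  · obtain ⟨hz', he⟩ := mem_pow_domain_of_nonpos A h z
    refine ⟨negPow A (-α) z, by rw [scaleNorm, dif_pos hz', he], ?_⟩
    rw [← hA.negPow_add_apply (by linarith) (by linarith)]
    congr 2
    ring
  · obtain ⟨ζ, rfl⟩ := (hA.mem_pow_domain_iff h).1 hz
    refine ⟨ζ, by rw [hA.scaleNorm_negPow h.le le_rfl, sub_self, negPow_zero,
      one_apply_eq_self], ?_⟩
    rw [← hA.negPow_add_apply (by norm_num) h.le, add_comm]

theorem isWeaklyControllable_of_isWeaklyObservable {α T : ℝ} (hα : -(1 / 2) < α) (hT : 0 < T)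
    (h : IsWeaklyObservable B α T) : IsWeaklyControllable B α T := by
  obtain ⟨C, hC, h⟩ := (hA.isWeaklyObservable_iff B hα).1 h
  refine ⟨C⁻¹, inv_pos.2 hC, fun z₀ _ hz₀ z₁ _ hz₁ => ?_⟩
  obtain ⟨ζ₀, rfl⟩ := (hA.mem_pow_domain_iff (by linarith)).1 hz₀
  obtain ⟨ζ₁, hn, hζ₁⟩ := hA.exists_negPow_eq_of_mem_pow_domain hα hz₁
  -- The conjugate of the moments that the control must have, with z⁰ = A^(-α-1/2)ζ₀ and A^(-1/2)z¹
  -- = A^(-α-1/2)ζ₁. Cauchy–Schwarz and observability bound it by K‖Λ(a,b)‖, so controllability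
  -- holds with constant C⁻¹.
  set ℓ : H × H →ₗ[𝕜] 𝕜 := ((innerSL 𝕜 (-ζ₁)).comp (negPow A (α + 1))).toLinearMap.comp
      (LinearMap.fst 𝕜 H H)
    + ((innerSL 𝕜 ζ₀).comp (negPow A (α + 1))).toLinearMap.comp (LinearMap.snd 𝕜 H H)
  have hℓ : ∀ a b, ℓ (a, b) = ⟪-ζ₁, negPow A (α + 1) a⟫_𝕜 + ⟪ζ₀, negPow A (α + 1) b⟫_𝕜 :=
    fun a b => rfl
  set K := √(C⁻¹ * (‖ζ₀‖ ^ 2 + ‖ζ₁‖ ^ 2))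
  have hK2 : K ^ 2 = C⁻¹ * (‖ζ₀‖ ^ 2 + ‖ζ₁‖ ^ 2) := Real.sq_sqrt (by positivity)
  obtain ⟨v, hvK, hv⟩ := exists_inner_eq_of_norm_le (hA.outputMap B T) ℓ
    (Real.sqrt_nonneg _ : 0 ≤ K)
    (by
      rintro ⟨a, b⟩
      refine le_of_sq_le_sq ?_ (by positivity)
      rw [hℓ, mul_pow, hK2]
      refine (norm_inner_add_inner_sq_le _ _ _ _).trans ?_
      rw [norm_neg, add_comm (‖ζ₁‖ ^ 2)]
      have := h a b
      rw [mul_comm C⁻¹, mul_assoc]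
      gcongr
      rw [inv_mul_eq_div, le_div_iff₀ hC, mul_comm]
      exact this)
  refine ⟨v, Lp.memLp v, ?_, ?_⟩
  · rw [hn, hA.scaleNorm_negPow (by linarith) le_rfl, sub_self, negPow_zero, one_apply_eq_self,
      ofReal_mul_enorm_sq_add (inv_nonneg.2 hC.le), ← hK2, ← enorm_toLp_two_sq (Lp.memLp v),
      enorm_sq_eq_ofReal, Lp.toLp_coeFn]
    gcongr
  · rw [hA.exists_isControlledSolution_indicator_iff B hT (Lp.memLp v)]
    intro a b
    have hs : ∀ x y, ⟪negPow A (1 / 2) x, negPow A (α + 1 / 2) y⟫_𝕜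
        = ⟪negPow A (α + 1) x, y⟫_𝕜 := fun x y => by
      rw [hA.inner_negPow (by norm_num), hA.inner_negPow (by linarith),
        ← hA.negPow_add_apply (by norm_num) (by linarith)]
      congr 3
      ring
    rw [Lp.toLp_coeFn, ← inner_conj_symm, hv, hℓ, map_add, inner_conj_symm, inner_conj_symm, hζ₁,
      inner_neg_right, inner_neg_right, hs, hs]

/-- Formally, one steers z⁰ = A^(-α-1/2)y₀, z¹ = A^(-α)y₁, whose control costs at most C(‖y₀‖² +
‖y₁‖²), and pairs the control with Λ(a,b). The choice of y₀, y₁ that maximises the pairing gives the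
inequality. -/
theorem isWeaklyObservable_of_isWeaklyControllable {α T : ℝ} (hα : -(1 / 2) < α) (hT : 0 < T)
    (h : IsWeaklyControllable B α T) : IsWeaklyObservable B α T := by
  obtain ⟨C, hC, h⟩ := h
  refine (hA.isWeaklyObservable_iff B hα).2 ⟨C⁻¹, inv_pos.2 hC, fun a b => ?_⟩
  set N := ‖hA.outputMap B T (a, b)‖
  set P := negPow A (α + 1)
  have key : ∀ y₁ y₀ : H, ‖⟪P a, -y₁⟫_𝕜 + ⟪P b, y₀⟫_𝕜‖ ^ 2
      ≤ N ^ 2 * (C * (‖y₀‖ ^ 2 + ‖y₁‖ ^ 2)) := by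
    intro y₁ y₀
    -- For general y₀, y₁ the data need not lie in H_1 × H_{1/2}. They do when y₀, y₁ lie in the
    -- dense range of A⁻¹, and the final inequality is continuous in y₀, y₁.
    induction y₁, y₀ using hA.denseRange_boundedInverse.induction_on₂ with
    | hp => exact isClosed_le (by fun_prop) (by fun_prop)
    | h y₁ y₀ =>
      have hα1 : 0 ≤ α + 1 := by linarith
      have hα2 : 0 ≤ α + 1 / 2 := by linarith
      have hz₁ : negPow A (α + 1) y₁ ∈ (pow A α).domain := by
        rcases le_or_gt α 0 with h0 | h0
        · exact (mem_pow_domain_of_nonpos A h0 _).1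
        · exact (hA.mem_pow_domain_iff h0).2
            ⟨negPow A 1 y₁, (hA.negPow_add_apply h0.le zero_le_one _).symm⟩
      have hz₀ : negPow A (1 + (α + 1 / 2)) y₀ ∈ (pow A (α + 1 / 2)).domain :=
        (hA.mem_pow_domain_iff (by linarith)).2 ⟨negPow A 1 y₀, by
          rw [← hA.negPow_add_apply hα2 zero_le_one, add_comm]⟩
      obtain ⟨v, hv, hvn, hvc⟩ := h (negPow A (1 + (α + 1 / 2)) y₀)
        (hA.mem_domain_iff.2 ⟨negPow A (α + 1 / 2) y₀, by
          rw [← negPow_one, ← hA.negPow_add_apply zero_le_one hα2]⟩) hz₀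
        (negPow A (α + 1) y₁) ((hA.mem_pow_domain_iff (by norm_num)).2
          ⟨negPow A (α + 1 / 2) y₁, by
            rw [← hA.negPow_add_apply (by norm_num) hα2]
            congr 2
            ring⟩) hz₁
      have hin := (hA.exists_isControlledSolution_indicator_iff B hT hv _ _).1 hvc a b
      rw [← enorm_toLp_two_sq hv, hA.scaleNorm_negPow (by linarith) (by linarith),
        hA.scaleNorm_negPow hα1 (by linarith), ofReal_mul_enorm_sq_add hC.le, enorm_sq_eq_ofReal,
        ENNReal.ofReal_le_ofReal_iff (by positivity), add_sub_cancel_right, add_sub_cancel_left,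
        negPow_one] at hvn
      have hs : ∀ x y : H, ⟪negPow A (1 / 2) x, negPow A (1 + (α + 1 / 2)) y⟫_𝕜
          = ⟪P x, boundedInverse A y⟫_𝕜 := fun x y => by
        rw [hA.inner_negPow (by norm_num), hA.inner_negPow hα1, ← negPow_one,
          ← hA.negPow_add_apply (by norm_num) (by linarith), ← hA.negPow_add_apply hα1 zero_le_one]
        congr 3
        ring
      have hs' : ⟪negPow A (1 / 2) a, negPow A (1 / 2) (negPow A (α + 1) y₁)⟫_𝕜
          = ⟪P a, boundedInverse A y₁⟫_𝕜 := by
        rw [← hs, ← hA.negPow_add_apply (by norm_num) hα1]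
        congr 3
        ring
      rw [inner_neg_right, hs, hs', ← inner_neg_right] at hin
      rw [← hin]
      calc _ ≤ (N * ‖hv.toLp v‖) ^ 2 := by
            gcongr
            exact norm_inner_le_norm _ _
        _ ≤ _ := by
            rw [mul_pow]
            gcongr
  -- This choice turns the pairing into D = ‖Pa‖² + ‖Pb‖² and gives D² ≤ N²CD; dividing by D, when
  -- it is nonzero, gives observability with constant C⁻¹.
  have h1 := key (-P a) (P b)
  rw [neg_neg, inner_self_eq_norm_sq_to_K, inner_self_eq_norm_sq_to_K, norm_neg] at h1
  norm_cast at h1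
  rw [sq_abs, add_comm (‖P b‖ ^ 2)] at h1
  rw [inv_mul_le_iff₀ hC]
  set D := ‖P a‖ ^ 2 + ‖P b‖ ^ 2
  rcases (show 0 ≤ D by positivity).eq_or_lt with h0 | h0
  · rw [← h0]
    positivity
  · refine le_of_mul_le_mul_right ?_ h0
    nlinarith

end IsPositiveInvertible
end Duality

end

end WaveControl

theorem mainTheorem2 {𝕜 : Type*} [RCLike 𝕜]
    {H : Type*} [NormedAddCommGroup H] [InnerProductSpace 𝕜 H] [CompleteSpace H]
    [NormedSpace ℝ H] [IsScalarTower ℝ 𝕜 H]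
    {U : Type*} [NormedAddCommGroup U] [InnerProductSpace 𝕜 U] [CompleteSpace U]
    (A : H →ₗ.[𝕜] H) (hA : WaveControl.IsPositiveInvertible A)
    (B : U →L[𝕜] WaveControl.NegScale A (1 / 2))
    (α : ℝ) (hα : -(1 / 2) < α) (T : ℝ) (hT : 0 < T) :
    WaveControl.IsWeaklyObservable B α T ↔ WaveControl.IsWeaklyControllable B α T := by
  exact ⟨hA.isWeaklyControllable_of_isWeaklyObservable B hα hT,
    hA.isWeaklyObservable_of_isWeaklyControllable B hα hT⟩
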